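/- Let $\overline\rho>0$ and consider $\rho_t+f(\rho)_x=(D(\rho)\rho_x)_x+g(\rho)$, where $f,D\in C^1[0,\overline\rho]$, $f(0)=0$, $g\in C[0,\overline\rho]$; put $h=f'$ and write $\dot D$ for the derivative of $D$ (one-sided at the end points of $[0,\overline\rho]$). \emph{Definitions.} Let $I\subseteq\mathbb R$ be an open interval and $c\in\mathbb R$. A continuous function $\varphi:I\to[0,\overline\rho]$, differentiable a.e., with $D(\varphi)\varphi'\in L^1_{\rm loc}(I)$, is the profile of a \emph{traveling wave} $\rho(x,t)=\varphi(x-ct)$ with speed $c$ on $I$ if $$\int_I\big\{\big(D(\varphi)\varphi'-f(\varphi)+c\varphi\big)\psi'-g(\varphi)\psi\big\}\,d\xi=0\qquad\text{for all }\psi\in C_0^\infty(I);$$ here $D(\varphi)\varphi'$ is understood to be also the distributional derivative of $\int_0^{\varphi}D(s)\,ds$. It is \emph{classical} in an open set $U\subseteq I$ if $\varphi$ is differentiable in $U$, $D(\varphi)\varphi'$ is locally absolutely continuous in $U$ and $(D(\varphi)\varphi')'+(c-h(\varphi))\varphi'+g(\varphi)=0$ a.e. in $U$; it is \emph{classical}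 if this holds for $U=I$. It is \emph{sharp at $\ell$} if $g(\ell)=0$ and there is $\xi_0\in I$ with $\varphi(\xi_0)=\ell$ such that $\varphi$ is classical in $I\setminus\{\xi_0\}$ and not differentiable at $\xi_0$; it is \emph{sharp} if it is sharp at some $\ell$. It is \emph{strict} if $I\ne\mathbb R$ and $\varphi$ is not the restriction to $I$ of a traveling-wave profile with speed $c$ on $\mathbb R$. It is a \emph{semi-wavefront from $\ell$}, where $\ell\in[0,\overline\rho]$ and $g(\ell)=0$, if $I=(-\infty,\varpi)$ with $\varpi\in\mathbb R$, $\varphi$ is (weakly) monotone and not constant, and $\varphi(\xi)\to\ell$ as $\xi\to-\infty$. \emph{Theorem.} Assume $D>0$ on $(0,\overline\rho)$, $g<0$ on $(0,\overline\rho]$ and $g(0)=0$. Then for every $c\in\mathbb R$ there is a semi-wavefront $\varphi:(-\infty,\varpi)\to[0,\overline\rho]$ from $0$ with speed $c$ which is classical or sharp, is strict, and is unique up to shifts in the class of classical or sharp solutions: every classical or sharp semi-wavefront from $0$ with speed $c$, defined on $(-\infty,\varpi')$ say, has the form $\xi\mapsto\varphi(\xi+\tau)$ on $(-\infty,\varpi')$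 for some $\tau\in\mathbb R$ with $\varpi'+\tau\le\varpi$. Moreover: \begin{itemize} \item if $D(0)>0$, then $\varphi$ is classical; \item if $D(0)=0$ and $c<h(0)$, then $\varphi$ is sharp (at $0$); \item if $D(0)=0$ and $c>h(0)$, then $\varphi$ is classical; \item if $D(0)=0$, $c=h(0)$ and $\dot D(0)>0$, then $\varphi$ is classical. \end{itemize} If $D(0)=0$, $c=h(0)$ and $\dot D(0)=0$, then $\varphi$ can be of either type: for every $\overline\rho>0$ and $c\in\mathbb R$ there are $f,D,g$ satisfying all the assumptions, with $D(0)=\dot D(0)=0$ and $h(0)=c$, for which there is a classical semi-wavefront from $0$ with speed $c$, and there are such $f,D,g$ for which there is a semi-wavefront from $0$ with speed $c$ that is sharp at $0$. -/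

import Mathlib

open MeasureTheory Filter Topology Set
open scoped ContDiff

namespace SemiWave

/-- Regularity of the flux `f`, the diffusivity `D` and the source term `g` on `[0, r]`. Only the
values of these functions on `[0, r]` matter. -/
structure IsData (r : ℝ) (f D g : ℝ → ℝ) : Prop where
  f_contDiffOn : ContDiffOn ℝ 1 f (Icc 0 r)
  f_zero : f 0 = 0
  D_contDiffOn : ContDiffOn ℝ 1 D (Icc 0 r)
  g_continuousOn : ContinuousOn g (Icc 0 r)

/-- The diffusivity is positive in the open interval `(0, r)`. -/
def DHat (r : ℝ) (D : ℝ → ℝ) : Prop := ∀ s ∈ Ioo 0 r, 0 < D s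

/-- The source term is negative in `(0, r]` and vanishes at `0`. -/
def GHat (r : ℝ) (g : ℝ → ℝ) : Prop := (∀ s ∈ Ioc 0 r, g s < 0) ∧ g 0 = 0

/-- The derivative on `[0, r]`, one-sided at the end points. -/
noncomputable def dot (r : ℝ) (F : ℝ → ℝ) (s : ℝ) : ℝ := derivWithin F (Icc 0 r) s

/-- The function `D(φ) φ'`. -/
noncomputable def diffFlux (D φ : ℝ → ℝ) (ξ : ℝ) : ℝ := D (φ ξ) * deriv φ ξ

/-- `φ` is the profile, on the open interval `I`, of a traveling-wave solution
`ρ(x,t) = φ (x - c t)` of `ρ_t + f(ρ)_x = (D(ρ) ρ_x)_x + g(ρ)` with values in `[0, r]`. -/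
structure IsTravelingWave (r : ℝ) (f D g : ℝ → ℝ) (c : ℝ) (I : Set ℝ) (φ : ℝ → ℝ) : Prop where
  isOpen : IsOpen I
  ordConnected : I.OrdConnected
  mapsTo : MapsTo φ I (Icc 0 r)
  continuousOn : ContinuousOn φ I
  ae_differentiableAt : ∀ᵐ ξ ∂(volume.restrict I), DifferentiableAt ℝ φ ξ
  locallyIntegrableOn : LocallyIntegrableOn (diffFlux D φ) I volume
  /-- The function `D(φ) φ'` is the distributional derivative of `P(φ)`, where `P` is the primitive
  of `D`: the continuous function `φ` has no singular (Cantor) part that the pointwise derivative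
  would not see. -/
  weakDeriv : ∀ ψ : ℝ → ℝ, ContDiff ℝ ∞ ψ → HasCompactSupport ψ → tsupport ψ ⊆ I →
    ∫ ξ in I, (∫ s in (0 : ℝ)..(φ ξ), D s) * deriv ψ ξ = - ∫ ξ in I, diffFlux D φ ξ * ψ ξ
  weakEquation : ∀ ψ : ℝ → ℝ, ContDiff ℝ ∞ ψ → HasCompactSupport ψ → tsupport ψ ⊆ I →
    ∫ ξ in I, ((diffFlux D φ ξ - f (φ ξ) + c * φ ξ) * deriv ψ ξ - g (φ ξ) * ψ ξ) = 0

/-- `φ` is a classical solution of `(D(φ) φ')' + (c - h(φ)) φ' + g(φ) = 0`, `h = f'`, in the open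
set `U`: it is differentiable in `U`, the function `D(φ) φ'` is (locally) absolutely continuous,
and the equation holds almost everywhere. -/
structure IsClassicalOn (r : ℝ) (f D g : ℝ → ℝ) (c : ℝ) (U : Set ℝ) (φ : ℝ → ℝ) : Prop where
  differentiableAt : ∀ ξ ∈ U, DifferentiableAt ℝ φ ξ
  absolutelyContinuous : ∀ a b : ℝ, a ≤ b → Icc a b ⊆ U →
    AbsolutelyContinuousOnInterval (diffFlux D φ) a b
  equation : ∀ᵐ ξ ∂(volume.restrict U),
    deriv (diffFlux D φ) ξ + (c - dot r f (φ ξ)) * deriv φ ξ + g (φ ξ) = 0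

/-- `φ` is sharp at `l` in the open interval `I`. -/
def IsSharpAt (r : ℝ) (f D g : ℝ → ℝ) (c : ℝ) (I : Set ℝ) (φ : ℝ → ℝ) (l : ℝ) : Prop :=
  g l = 0 ∧ ∃ ξ₀ ∈ I, φ ξ₀ = l ∧ IsClassicalOn r f D g c (I \ {ξ₀}) φ ∧ ¬ DifferentiableAt ℝ φ ξ₀

/-- `φ` is classical or sharp (at some value) in `I`. -/
def IsClassicalOrSharp (r : ℝ) (f D g : ℝ → ℝ) (c : ℝ) (I : Set ℝ) (φ : ℝ → ℝ) : Prop :=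
  IsClassicalOn r f D g c I φ ∨ ∃ l, IsSharpAt r f D g c I φ l

/-- The profile `φ` on `I ≠ ℝ` does not extend to the profile of a traveling wave on `ℝ`. -/
def IsStrict (r : ℝ) (f D g : ℝ → ℝ) (c : ℝ) (I : Set ℝ) (φ : ℝ → ℝ) : Prop :=
  I ≠ univ ∧ ¬ ∃ Φ : ℝ → ℝ, IsTravelingWave r f D g c univ Φ ∧ EqOn Φ φ I

/-- `φ` is the profile, on `(-∞, b)`, of a semi-wavefront solution from `l`. -/
structure IsSemiWavefrontFrom (r : ℝ) (f D g : ℝ → ℝ) (c l b : ℝ) (φ : ℝ → ℝ) : Prop where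
  isTravelingWave : IsTravelingWave r f D g c (Iio b) φ
  mem_Icc : l ∈ Icc 0 r
  g_eq_zero : g l = 0
  monotonic : MonotoneOn φ (Iio b) ∨ AntitoneOn φ (Iio b)
  nonconstant : ¬ ∃ k, ∀ ξ ∈ Iio b, φ ξ = k
  tendsto : Tendsto φ atBot (𝓝 l)

end SemiWave

/-! Where a monotone wave is positive, its value `s = φ` can serve as the independent variable.
Writing `z(s)` for the flux `D(φ) φ'` at the point where `φ = s`, the second order equation becomes
the singular first order problem `z' = h - c - D g / z`, `z(0) = 0`, `z > 0` on `(0, r)`. Everything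
is read off from `z`.

Existence of `z`: the singularity at `0` is removed by starting at `ε > 0` and adding `M ε` to the
numerator, with `M` a bound of `|h - c|`; this makes the constant `ε` a lower barrier. Since `-D g ≥
0`, the right-hand side is nonincreasing in `z`, so the approximations decrease with `ε`. Barriers
bound them above on `[0, r]` and away from zero on compact subsets of `(0, r)`, and the limit solves
the problem (`exists_firstOrderSol`).

From `z` to the wave: `φ` is the inverse of `T = ∫ D / z`. As `g` is bounded away from zero near
`r`, `D / z` is dominated there by a multiple of `-D g / z = z' - (h - c)`, so `T` stays bounded and
the wave ends at a finite point. Towards `0`, either `T` is unbounded below and `φ` is positive, or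
`φ` reaches `0` at a finite point and is continued by `0`; the flux is continuous there because
`z(0) = 0` (`exists_isProfile`, `IsProfile.hasDerivAt_comp`).

Strictness: an extension would have the value `r` at the end point, where the primitive of `D` along
the wave is maximal and the flux vanishes. The integrated equation then makes the flux positive just
to the right, which pushes this primitive above its maximum.

Uniqueness: for any admissible wave `θ`, the difference `u` of its flux and `z(θ)` satisfies `u' =
g(θ) u / z(θ)`, so it is damped to the right. Both fluxes are small at suitable points near the left
end, whence `u = 0` and `T(θ(ξ)) - ξ` is constant (`IsSemiWavefrontFrom.diffFlux_eq`,
`exists_shift`).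

Type: the slope is `φ' = z / D`, so smoothness at the point where `φ` leaves `0` depends on `z / D`
near `0`. Comparison of `z` with multiples of `D` settles all cases except `D(0) = 0`, `c = h(0)`,
`D'(0) = 0`, where explicit pairs `(z, D)` show both behaviours. -/

namespace SemiWave

/-! ### Auxiliary facts of real analysis -/

/-- A function that starts nonpositive and does not increase where it is positive stays
nonpositive. -/
theorem nonpos_of_deriv_nonpos_of_pos {u : ℝ → ℝ} {a b : ℝ} (hu : ContinuousOn u (Icc a b))
    (ha : u a ≤ 0) (hd : ∀ s ∈ Ioo a b, 0 < u s → ∃ d ≤ 0, HasDerivAt u d s) :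
    ∀ s ∈ Icc a b, u s ≤ 0 := by
  intro s hs
  by_contra! hpos
  have hsub : Icc a s ⊆ Icc a b := Icc_subset_Icc_right hs.2
  have hcl : IsCompact (Icc a s ∩ u ⁻¹' Iic 0) :=
    isCompact_Icc.of_isClosed_subset
      ((hu.mono hsub).preimage_isClosed_of_isClosed isClosed_Icc isClosed_Iic) inter_subset_left
  -- At the last point `t` before `s` with `u t ≤ 0`, positivity takes over on `(t, s)`, where `u`
  -- cannot increase.
  obtain ⟨t, ⟨⟨hat, hts⟩, htu⟩, hmax⟩ := hcl.exists_isGreatest ⟨a, ⟨le_rfl, hs.1⟩, ha⟩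
  have hpos' : ∀ x ∈ Ioo t s, 0 < u x := by
    intro x hx
    by_contra! h
    exact absurd (hmax ⟨⟨hat.trans hx.1.le, hx.2.le⟩, h⟩) (not_le.2 hx.1)
  have hder : ∀ x ∈ Ioo t s, ∃ d ≤ 0, HasDerivAt u d x := fun x hx =>
    hd x ⟨hat.trans_lt hx.1, hx.2.trans_le hs.2⟩ (hpos' x hx)
  have hanti : AntitoneOn u (Icc t s) := by
    refine antitoneOn_of_deriv_nonpos (convex_Icc t s)
      (hu.mono (Icc_subset_Icc hat hs.2)) ?_ ?_
    · rw [interior_Icc]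
      intro x hx
      obtain ⟨d, -, h⟩ := hder x hx
      exact h.differentiableAt.differentiableWithinAt
    · rw [interior_Icc]
      intro x hx
      obtain ⟨d, hd0, h⟩ := hder x hx
      rwa [h.deriv]
  exact absurd (hanti ⟨le_rfl, hts⟩ ⟨hts, le_rfl⟩ hts) (not_le.2 (lt_of_le_of_lt htu hpos))

/-- The fundamental theorem of calculus on an open interval. -/
theorem hasDerivAt_primitive {v : ℝ → ℝ} {I : Set ℝ} (hI : IsOpen I) (hc : I.OrdConnected)
    (hv : ContinuousOn v I) {x₀ x : ℝ} (hx₀ : x₀ ∈ I) (hx : x ∈ I) :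
    HasDerivAt (fun y => ∫ t in x₀..y, v t) (v x) x := by
  refine intervalIntegral.integral_hasDerivAt_right ?_ ?_ (hv.continuousAt (hI.mem_nhds hx))
  · exact (hv.mono (hc.uIcc_subset hx₀ hx)).intervalIntegrable
  · exact hv.stronglyMeasurableAtFilter hI x hx

/-- A function that is continuous at `x`, with a derivative near `x` that extends continuously to
`x`, is differentiable at `x`. -/
theorem hasDerivAt_of_eventually_ne {F G : ℝ → ℝ} {x : ℝ}
    (h : ∀ᶠ y in 𝓝[≠] x, HasDerivAt F (G y) y) (hF : ContinuousAt F x) (hG : ContinuousAt G x) :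
    HasDerivAt F (G x) x := by
  have hr : HasDerivWithinAt F (G x) (Ici x) x := by
    have hev : ∀ᶠ y in 𝓝[>] x, HasDerivAt F (G y) y :=
      h.filter_mono (nhdsWithin_mono _ fun y hy => ne_of_gt hy)
    refine hasDerivWithinAt_Ici_of_tendsto_deriv (s := {y | HasDerivAt F (G y) y} )
      (fun y hy => (hy : HasDerivAt F (G y) y).differentiableAt.differentiableWithinAt)
      hF.continuousWithinAt hev ?_
    refine (hG.continuousWithinAt (s := Ioi x)).tendsto.congr' ?_
    filter_upwards [hev] with y hy using hy.deriv.symm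
  have hl : HasDerivWithinAt F (G x) (Iic x) x := by
    have hev : ∀ᶠ y in 𝓝[<] x, HasDerivAt F (G y) y :=
      h.filter_mono (nhdsWithin_mono _ fun y hy => ne_of_lt hy)
    refine hasDerivWithinAt_Iic_of_tendsto_deriv (s := {y | HasDerivAt F (G y) y} )
      (fun y hy => (hy : HasDerivAt F (G y) y).differentiableAt.differentiableWithinAt)
      hF.continuousWithinAt hev ?_
    refine (hG.continuousWithinAt (s := Iio x)).tendsto.congr' ?_
    filter_upwards [hev] with y hy using hy.deriv.symm
  simpa using hl.union hr

/-- The product of a function that is continuous on an open set with a test function supported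
there is continuous. -/
theorem continuous_mul_of_tsupport_subset {u ψ : ℝ → ℝ} {I : Set ℝ} (hI : IsOpen I)
    (hu : ContinuousOn u I) (hψ : Continuous ψ) (hs : tsupport ψ ⊆ I) :
    Continuous fun x => u x * ψ x := by
  refine continuous_iff_continuousAt.2 fun x => ?_
  by_cases hx : x ∈ I
  · exact (hu.continuousAt (hI.mem_nhds hx)).mul hψ.continuousAt
  · have h0 : ψ =ᶠ[𝓝 x] 0 := notMem_tsupport_iff_eventuallyEq.1 fun h => hx (hs h)
    have : (fun x => u x * ψ x) =ᶠ[𝓝 x] fun _ => 0 := by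
      filter_upwards [h0] with y hy
      simp [hy]
    exact continuousAt_const.congr this.symm

theorem setIntegral_eq_integral_mul {u ψ : ℝ → ℝ} {I : Set ℝ} (hs : tsupport ψ ⊆ I) :
    ∫ x in I, u x * ψ x = ∫ x, u x * ψ x :=
  setIntegral_eq_integral_of_forall_compl_eq_zero fun x hx => by
    rw [image_eq_zero_of_notMem_tsupport fun h => hx (hs h), mul_zero]

/-- A locally integrable function times a test function is integrable. -/
theorem integrableOn_mul_test {u ψ : ℝ → ℝ} {I : Set ℝ}
    (hu : LocallyIntegrableOn u I volume) (hψ : Continuous ψ) (hc : HasCompactSupport ψ)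
    (hs : tsupport ψ ⊆ I) : IntegrableOn (fun x => u x * ψ x) I volume := by
  have h1 : IntegrableOn u (tsupport ψ) volume := hu.integrableOn_compact_subset hs hc
  have h2 : IntegrableOn (fun x => u x * ψ x) (tsupport ψ) volume :=
    h1.mul_continuousOn hψ.continuousOn hc
  have h3 : Integrable (fun x => u x * ψ x) volume := by
    refine (integrableOn_iff_integrable_of_support_subset ?_).1 h2
    intro x hx
    by_contra h
    exact hx (by simp [image_eq_zero_of_notMem_tsupport h])
  exact h3.integrableOn

/-- Integration by parts against a test function. -/
theorem setIntegral_mul_deriv_test {u v ψ : ℝ → ℝ} {I : Set ℝ} (hI : IsOpen I)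
    (hu : ∀ x ∈ I, HasDerivAt u (v x) x) (hv : ContinuousOn v I)
    (hψ : ContDiff ℝ ∞ ψ) (hc : HasCompactSupport ψ) (hs : tsupport ψ ⊆ I) :
    ∫ x in I, u x * deriv ψ x = -∫ x in I, v x * ψ x := by
  have hucont : ContinuousOn u I := fun x hx => (hu x hx).continuousAt.continuousWithinAt
  have hdψ : Continuous (deriv ψ) := hψ.continuous_deriv (by simp)
  have hsd : tsupport (deriv ψ) ⊆ I := (tsupport_deriv_subset (𝕜 := ℝ) (f := ψ)).trans hs
  have c1 : Continuous fun x => u x * deriv ψ x :=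
    continuous_mul_of_tsupport_subset hI hucont hdψ hsd
  have c2 : Continuous fun x => v x * ψ x :=
    continuous_mul_of_tsupport_subset hI hv hψ.continuous hs
  have c0 : Continuous fun x => u x * ψ x :=
    continuous_mul_of_tsupport_subset hI hucont hψ.continuous hs
  have i1 : Integrable fun x => u x * deriv ψ x :=
    c1.integrable_of_hasCompactSupport hc.deriv.mul_left
  have i2 : Integrable fun x => v x * ψ x := c2.integrable_of_hasCompactSupport hc.mul_left
  have i0 : Integrable fun x => u x * ψ x := c0.integrable_of_hasCompactSupport hc.mul_left
  have hder : ∀ x, HasDerivAt (fun x => u x * ψ x) (v x * ψ x + u x * deriv ψ x) x := by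
    intro x
    by_cases hx : x ∈ I
    · exact (hu x hx).mul ((hψ.differentiable (by simp)) x).hasDerivAt
    · have hx' : x ∉ tsupport ψ := fun h => hx (hs h)
      have h0 : ψ =ᶠ[𝓝 x] 0 := notMem_tsupport_iff_eventuallyEq.1 hx'
      have h1 : (fun x => u x * ψ x) =ᶠ[𝓝 x] fun _ => 0 := by
        filter_upwards [h0] with y hy
        simp [hy]
      rw [image_eq_zero_of_notMem_tsupport hx',
        image_eq_zero_of_notMem_tsupport fun h => hx (hsd h)]
      simpa using (hasDerivAt_const x (0 : ℝ)).congr_of_eventuallyEq h1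
  have := integral_eq_zero_of_hasDerivAt_of_integrable hder (i2.add i1) i0
  rw [integral_add i2 i1] at this
  rw [setIntegral_eq_integral_mul hsd, setIntegral_eq_integral_mul hs]
  linarith

/-- A compact subset of a nonempty set of reals lies in a compact interval with end points in the
set. -/
theorem exists_Icc_superset {I K : Set ℝ} (hK : IsCompact K) (hKI : K ⊆ I)
    (hne : I.Nonempty) : ∃ a ∈ I, ∃ b ∈ I, a ≤ b ∧ K ⊆ Icc a b := by
  rcases K.eq_empty_or_nonempty with rfl | h
  · obtain ⟨x, hx⟩ := hne
    exact ⟨x, hx, x, hx, le_rfl, empty_subset _⟩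
  · obtain ⟨a, ha, hmin⟩ := hK.exists_isLeast h
    obtain ⟨b, hb, hmax⟩ := hK.exists_isGreatest h
    exact ⟨a, hKI ha, b, hKI hb, hmin hb, fun x hx => ⟨hmin hx, hmax hx⟩⟩

/-- A test function with vanishing integral is the derivative of a test function. -/
theorem exists_test_primitive {η : ℝ → ℝ} {I : Set ℝ} (hcI : I.OrdConnected)
    (hη : ContDiff ℝ ∞ η) (hc : HasCompactSupport η) (hs : tsupport η ⊆ I) (h0 : ∫ x, η x = 0)
    (hne : I.Nonempty) :
    ∃ ψ : ℝ → ℝ, ContDiff ℝ ∞ ψ ∧ HasCompactSupport ψ ∧ tsupport ψ ⊆ I ∧ deriv ψ = η := by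
  obtain ⟨a, ha, b, hb, hab, hsub⟩ := exists_Icc_superset hc hs hne
  have hz : ∀ x, x ∉ Icc a b → η x = 0 := fun x hx =>
    image_eq_zero_of_notMem_tsupport fun h => hx (hsub h)
  have hder : ∀ x, HasDerivAt (fun y => ∫ t in a..y, η t) (η x) x := fun x =>
    hasDerivAt_primitive isOpen_univ ordConnected_univ hη.continuous.continuousOn (mem_univ _)
      (mem_univ _)
  have hderiv : deriv (fun y => ∫ t in a..y, η t) = η := funext fun x => (hder x).deriv
  have hsupp : ∀ x, x ∉ Icc a b → ∫ t in a..x, η t = 0 := by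
    intro x hx
    rcases lt_or_ge x a with hxa | hxa
    · rw [intervalIntegral.integral_symm, intervalIntegral.integral_of_le hxa.le, neg_eq_zero]
      rw [integral_Ioc_eq_integral_Ioo]
      exact setIntegral_eq_zero_of_forall_eq_zero fun t ht => hz t fun h => absurd h.1 (not_le.2 ht.2)
    · have hbx : b < x := by
        by_contra! h
        exact hx ⟨hxa, h⟩
      rw [intervalIntegral.integral_of_le hxa, ← h0, ← integral_Icc_eq_integral_Ioc]
      exact setIntegral_eq_integral_of_forall_compl_eq_zero fun t ht =>
        hz t fun h => ht ⟨h.1, h.2.trans hbx.le⟩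
  have hts : tsupport (fun y => ∫ t in a..y, η t) ⊆ Icc a b := by
    refine closure_minimal ?_ isClosed_Icc
    intro x hx
    by_contra h
    exact hx (hsupp x h)
  refine ⟨_, ?_, ?_, hts.trans (hcI.out ha hb), hderiv⟩
  · refine contDiff_infty_iff_deriv.2 ⟨fun x => (hder x).differentiableAt, ?_⟩
    rwa [hderiv]
  · exact isCompact_Icc.of_isClosed_subset (isClosed_tsupport _) hts

/-- There is a test function of integral one supported in a given nonempty open set. -/
theorem exists_test_integral_eq_one {I : Set ℝ} (hI : IsOpen I) {x₀ : ℝ} (hx₀ : x₀ ∈ I) :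
    ∃ ρ : ℝ → ℝ, ContDiff ℝ ∞ ρ ∧ HasCompactSupport ρ ∧ tsupport ρ ⊆ I ∧ ∫ x, ρ x = 1 := by
  obtain ⟨ε, hε, hball⟩ := Metric.isOpen_iff.1 hI x₀ hx₀
  let B : ContDiffBump x₀ := ⟨ε / 4, ε / 2, by positivity, by linarith⟩
  refine ⟨B.normed volume, B.contDiff_normed, B.hasCompactSupport_normed, ?_, B.integral_normed⟩
  rw [B.tsupport_normed_eq]
  refine (Metric.closedBall_subset_ball ?_).trans hball
  change ε / 2 < ε
  linarith

/-- The lemma of du Bois-Reymond: a locally integrable function with a continuous weak derivative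
is almost everywhere a primitive of it. -/
theorem ae_eq_primitive_of_weakDeriv {u v : ℝ → ℝ} {I : Set ℝ} (hI : IsOpen I)
    (hcI : I.OrdConnected) (hu : LocallyIntegrableOn u I volume) (hv : ContinuousOn v I)
    (hw : ∀ ψ : ℝ → ℝ, ContDiff ℝ ∞ ψ → HasCompactSupport ψ → tsupport ψ ⊆ I →
      ∫ x in I, u x * deriv ψ x = -∫ x in I, v x * ψ x) {x₀ : ℝ} (hx₀ : x₀ ∈ I) :
    ∃ K : ℝ, ∀ᵐ x ∂(volume.restrict I), u x = K + ∫ t in x₀..x, v t := by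
  obtain ⟨ρ, hρ, hρc, hρs, hρ1⟩ := exists_test_integral_eq_one hI hx₀
  set V : ℝ → ℝ := fun x => ∫ t in x₀..x, v t with hV
  have hVd : ∀ x ∈ I, HasDerivAt V (v x) x := fun x hx =>
    hasDerivAt_primitive hI hcI hv hx₀ hx
  have hVc : ContinuousOn V I := fun x hx => (hVd x hx).continuousAt.continuousWithinAt
  have hVl : LocallyIntegrableOn V I volume := hVc.locallyIntegrableOn hI.measurableSet
  have hUl : LocallyIntegrableOn (fun x => u x - V x) I volume := hu.sub hVl
  set K := ∫ x in I, (u x - V x) * ρ x with hK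
  have key : ∀ η : ℝ → ℝ, ContDiff ℝ ∞ η → HasCompactSupport η → tsupport η ⊆ I →
      ∫ x in I, (u x - V x) * deriv η x = 0 := by
    intro η h1 h2 h3
    have hdη : Continuous (deriv η) := h1.continuous_deriv (by simp)
    have hsd : tsupport (deriv η) ⊆ I := (tsupport_deriv_subset (𝕜 := ℝ) (f := η)).trans h3
    simp_rw [sub_mul]
    rw [integral_sub (integrableOn_mul_test hu hdη h2.deriv hsd)
      (integrableOn_mul_test hVl hdη h2.deriv hsd), hw η h1 h2 h3,
      setIntegral_mul_deriv_test hI hVd hv h1 h2 h3, sub_self]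
  refine ⟨K, ?_⟩
  have hz : ∀ᵐ x ∂volume, x ∈ I → u x - V x - K = 0 := by
    refine hI.ae_eq_zero_of_integral_contDiff_smul_eq_zero
      (f := fun x => u x - V x - K) (μ := volume) ?_ ?_
    · exact hUl.sub (continuousOn_const.locallyIntegrableOn hI.measurableSet)
    · intro ψ hψ hψc hψs
      -- Subtracting the multiple of `ρ` with the same integral leaves a function of mean zero,
      -- hence the derivative of a test function.
      have hη : ContDiff ℝ ∞ fun x => ψ x - (∫ y, ψ y) * ρ x := hψ.sub (contDiff_const.mul hρ)
      have hηc : HasCompactSupport fun x => ψ x - (∫ y, ψ y) * ρ x := hψc.sub hρc.mul_left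
      have hηs : tsupport (fun x => ψ x - (∫ y, ψ y) * ρ x) ⊆ I := by
        refine (tsupport_sub ψ fun x => (∫ y, ψ y) * ρ x).trans (union_subset hψs ?_)
        exact (tsupport_mul_subset_right).trans hρs
      have iψ : Integrable ψ := hψ.continuous.integrable_of_hasCompactSupport hψc
      have iρ : Integrable ρ := hρ.continuous.integrable_of_hasCompactSupport hρc
      have hη0 : ∫ x, (ψ x - (∫ y, ψ y) * ρ x) = 0 := by
        rw [integral_sub iψ (iρ.const_mul _), integral_const_mul, hρ1]
        ring
      obtain ⟨χ, χ1, χ2, χ3, χ4⟩ := exists_test_primitive hcI hη hηc hηs hη0 ⟨x₀, hx₀⟩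
      have h := key χ χ1 χ2 χ3
      rw [χ4] at h
      have e1 : ∫ x in I, (u x - V x) * (ψ x - (∫ y, ψ y) * ρ x)
          = (∫ x in I, (u x - V x) * ψ x) - (∫ y, ψ y) * K := by
        rw [hK, ← integral_const_mul, ← integral_sub
          (integrableOn_mul_test hUl hψ.continuous hψc hψs)
          ((integrableOn_mul_test hUl hρ.continuous hρc hρs).const_mul _)]
        congr 1
        ext x
        ring
      have e2 : ∫ x, ψ x • (u x - V x - K)
          = (∫ x in I, (u x - V x) * ψ x) - ∫ x in I, K * ψ x := by
        rw [← integral_sub (integrableOn_mul_test hUl hψ.continuous hψc hψs)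
          (iψ.const_mul K).integrableOn]
        rw [← setIntegral_eq_integral_of_forall_compl_eq_zero (s := I)]
        · congr 1
          ext x
          simp only [smul_eq_mul]
          ring
        · intro x hx
          rw [image_eq_zero_of_notMem_tsupport fun h => hx (hψs h), zero_smul]
      rw [e2, setIntegral_eq_integral_mul (u := fun _ => K) hψs, integral_const_mul]
      rw [e1] at h
      linarith
  rw [ae_restrict_iff' hI.measurableSet]
  filter_upwards [hz] with x hx hxI
  linarith [hx hxI]

/-! ### The first order problem `z' = k + q / z`, `z(0) = 0` -/

/-- `z` is a bounded positive solution of `z' = k + q / z` on `(0, r)` with `z(0) = 0`. -/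
structure IsFirstOrderSol (r : ℝ) (k q z : ℝ → ℝ) : Prop where
  zero : z 0 = 0
  continuousOn : ContinuousOn z (Ico 0 r)
  pos : ∀ s ∈ Ioo 0 r, 0 < z s
  hasDerivAt : ∀ s ∈ Ioo 0 r, HasDerivAt z (k s + q s / z s) s
  bddAbove : ∃ B, ∀ s ∈ Ioo 0 r, z s ≤ B

/-- The regularised problem has a solution bounded below by the parameter. -/
theorem exists_regularised_sol {r M Q ε : ℝ} {k q : ℝ → ℝ} (hr : 0 < r) (hε : 0 < ε)
    (hk : ContinuousOn k (Icc 0 r)) (hq : ContinuousOn q (Icc 0 r))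
    (hkM : ∀ s ∈ Icc 0 r, |k s| ≤ M) (hqQ : ∀ s ∈ Icc 0 r, q s ≤ Q)
    (hq0 : ∀ s ∈ Icc 0 r, 0 ≤ q s) :
    ∃ z : ℝ → ℝ, z 0 = ε ∧ ContinuousOn z (Icc 0 r) ∧ (∀ s ∈ Icc 0 r, ε ≤ z s) ∧
      ∀ s ∈ Ioo 0 r, HasDerivAt z (k s + (q s + M * ε) / z s) s := by
  have h0mem : (0 : ℝ) ∈ Icc 0 r := ⟨le_rfl, hr.le⟩
  have hM : 0 ≤ M := (abs_nonneg _).trans (hkM 0 h0mem)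
  have hQ : 0 ≤ Q := (hq0 0 h0mem).trans (hqQ 0 h0mem)
  -- Truncating the denominator at `ε` makes the right-hand side globally Lipschitz in `x`; the
  -- bound `ε ≤ z` proved below removes the truncation.
  let F : ℝ → ℝ → ℝ := fun s x => k s + (q s + M * ε) / max x ε
  have hmax : ∀ x : ℝ, 0 < max x ε := fun x => lt_max_of_lt_right hε
  have hinv : ∀ x y : ℝ, |(max x ε)⁻¹ - (max y ε)⁻¹| ≤ (ε * ε)⁻¹ * |x - y| := by
    intro x y
    rw [inv_sub_inv (hmax x).ne' (hmax y).ne', abs_div, div_eq_inv_mul,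
      abs_of_pos (mul_pos (hmax x) (hmax y))]
    refine mul_le_mul ?_ ?_ (abs_nonneg _) (by positivity)
    · exact inv_anti₀ (by positivity)
        (mul_le_mul (le_max_right _ _) (le_max_right _ _) hε.le (hmax x).le)
    · rw [abs_sub_comm x y]
      exact abs_max_sub_max_le_abs y x ε
  let L : ℝ := M + (Q + M * ε) / ε
  have hL : 0 ≤ L := by positivity
  let Kc : ℝ := (Q + M * ε) * (ε * ε)⁻¹
  have hKc : 0 ≤ Kc := by positivity
  -- With `|F| ≤ L` everywhere, a ball of radius `L * r` suffices for existence on all of `[0, r]`.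
  have hPL : IsPicardLindelof F (tmin := 0) (tmax := r) ⟨0, h0mem⟩ ε
      ⟨L * r, by positivity⟩ 0 ⟨L, hL⟩ ⟨Kc, hKc⟩ := by
    refine ⟨?_, ?_, ?_, ?_⟩
    · intro t ht
      refine LipschitzOnWith.of_dist_le_mul fun x _ y _ => ?_
      have h1 : F t x - F t y = (q t + M * ε) * ((max x ε)⁻¹ - (max y ε)⁻¹) := by
        simp only [F, div_eq_mul_inv]
        ring
      have h2 : 0 ≤ q t + M * ε := add_nonneg (hq0 t ht) (by positivity)
      change |F t x - F t y| ≤ Kc * |x - y|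
      rw [h1, abs_mul, abs_of_nonneg h2]
      calc (q t + M * ε) * |(max x ε)⁻¹ - (max y ε)⁻¹|
          ≤ (Q + M * ε) * ((ε * ε)⁻¹ * |x - y|) :=
            mul_le_mul (by linarith [hqQ t ht]) (hinv x y) (abs_nonneg _) (by positivity)
        _ = Kc * |x - y| := by ring
    · intro x _
      exact hk.add ((hq.add continuousOn_const).div_const _)
    · intro t ht x _
      change |k t + (q t + M * ε) / max x ε| ≤ L
      have h2 : 0 ≤ q t + M * ε := add_nonneg (hq0 t ht) (by positivity)
      refine (abs_add_le _ _).trans (add_le_add (hkM t ht) ?_)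
      rw [abs_of_nonneg (div_nonneg h2 (hmax x).le)]
      exact div_le_div₀ (by positivity) (by linarith [hqQ t ht]) hε (le_max_right _ _)
    · change L * max (r - 0) (0 - 0) ≤ L * r - 0
      simp [hr.le]
  obtain ⟨z, hz0, hz⟩ := hPL.exists_eq_forall_mem_Icc_hasDerivWithinAt₀
  have hz0' : z 0 = ε := hz0
  have hcont : ContinuousOn z (Icc 0 r) := fun s hs => (hz s hs).continuousWithinAt
  have hder : ∀ s ∈ Ioo 0 r, HasDerivAt z (F s (z s)) s := fun s hs =>
    (hz s (Ioo_subset_Icc_self hs)).hasDerivAt (Icc_mem_nhds hs.1 hs.2)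
  have hge : ∀ s ∈ Icc 0 r, ε ≤ z s := by
    intro s hs
    have := nonpos_of_deriv_nonpos_of_pos (u := fun s => ε - z s)
      (continuousOn_const.sub hcont) (by simp [hz0']) ?_ s hs
    · linarith
    · intro t ht hpos
      refine ⟨_, ?_, (hder t ht).const_sub ε⟩
      have hlt : z t < ε := by linarith
      have htI := Ioo_subset_Icc_self ht
      -- Below the level `ε` the added term contributes exactly `M`, which compensates `k ≥ -M`.
      have hF : F t (z t) = k t + q t / ε + M := by
        simp only [F, max_eq_right hlt.le]
        field_simp
        ring
      rw [hF]
      have := (abs_le.1 (hkM t htI)).1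
      have := div_nonneg (hq0 t htI) hε.le
      linarith
  refine ⟨z, hz0', hcont, hge, fun s hs => ?_⟩
  have := hder s hs
  simp only [F, max_eq_left (hge s (Ioo_subset_Icc_self hs))] at this
  exact this

/-- The first order problem is solvable. -/
theorem exists_firstOrderSol {r : ℝ} {k q : ℝ → ℝ} (hr : 0 < r)
    (hk : ContinuousOn k (Icc 0 r)) (hq : ContinuousOn q (Icc 0 r))
    (hq0 : ∀ s ∈ Icc 0 r, 0 ≤ q s) (hqpos : ∀ s ∈ Ioo 0 r, 0 < q s) :
    ∃ z, IsFirstOrderSol r k q z := by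
  have h0mem : (0 : ℝ) ∈ Icc 0 r := ⟨le_rfl, hr.le⟩
  obtain ⟨M, hkM⟩ := isCompact_Icc.exists_bound_of_continuousOn hk
  obtain ⟨Q, hqQ'⟩ := isCompact_Icc.exists_bound_of_continuousOn hq
  simp only [Real.norm_eq_abs] at hkM hqQ'
  have hqQ : ∀ s ∈ Icc 0 r, q s ≤ Q := fun s hs => (le_abs_self _).trans (hqQ' s hs)
  have hM : 0 ≤ M := (abs_nonneg _).trans (hkM 0 h0mem)
  have hQ : 0 ≤ Q := (hq0 0 h0mem).trans (hqQ 0 h0mem)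
  let ε : ℕ → ℝ := fun n => 1 / ((n : ℝ) + 1)
  have hε : ∀ n, 0 < ε n := fun n => Nat.one_div_pos_of_nat
  have hεanti : ∀ m n, m ≤ n → ε n ≤ ε m := fun m n h => Nat.one_div_le_one_div h
  have hε1 : ∀ n, ε n ≤ 1 := fun n => by simpa [ε] using hεanti 0 n (Nat.zero_le n)
  have hεlim : Tendsto ε atTop (𝓝 0) := tendsto_one_div_add_atTop_nhds_zero_nat
  choose Z hZ0 hZc hZε hZd using fun n =>
    exists_regularised_sol hr (hε n) hk hq hkM hqQ hq0
  have hZpos : ∀ n, ∀ s ∈ Icc 0 r, 0 < Z n s := fun n s hs => (hε n).trans_le (hZε n s hs)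
  -- Where the solution with the smaller parameter is the larger one, its quotient has the smaller
  -- numerator and the larger denominator, so the difference cannot increase.
  have hZanti : ∀ s ∈ Icc 0 r, Antitone fun n => Z n s := by
    intro s hs m n hmn
    have := nonpos_of_deriv_nonpos_of_pos (u := fun s => Z n s - Z m s)
      ((hZc n).sub (hZc m)) (by simp [hZ0, hεanti m n hmn]) ?_ s hs
    · exact sub_nonpos.1 this
    · intro t ht hpos
      refine ⟨_, ?_, (hZd n t ht).sub (hZd m t ht)⟩
      have htI := Ioo_subset_Icc_self ht
      have : (q t + M * ε n) / Z n t ≤ (q t + M * ε m) / Z m t :=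
        div_le_div₀ (add_nonneg (hq0 t htI) (mul_nonneg hM (hε m).le))
          (by gcongr; exact hεanti m n hmn) (hZpos m t htI) (by linarith)
      linarith
  -- Above the line `1 + (2 * M + Q) * s` the denominator is at least `1`, so the slope is at most
  -- `M + (Q + M)`, the slope of the line.
  have hZupper : ∀ n, ∀ s ∈ Icc 0 r, Z n s ≤ 1 + (2 * M + Q) * r := by
    intro n s hs
    have := nonpos_of_deriv_nonpos_of_pos (u := fun s => Z n s - (1 + (2 * M + Q) * s))
      ((hZc n).sub (by fun_prop)) (by simp [hZ0, hε1]) ?_ s hs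
    · have h2 : (2 * M + Q) * s ≤ (2 * M + Q) * r :=
        mul_le_mul_of_nonneg_left hs.2 (by positivity)
      linarith
    · intro t ht hpos
      have htI := Ioo_subset_Icc_self ht
      refine ⟨_, ?_, (hZd n t ht).sub (((hasDerivAt_id t).const_mul (2 * M + Q)).const_add 1)⟩
      have h1 : 1 ≤ Z n t := by
        have : 0 ≤ (2 * M + Q) * t := mul_nonneg (by positivity) ht.1.le
        linarith
      have h2 : (q t + M * ε n) / Z n t ≤ Q + M := by
        refine (div_le_self (add_nonneg (hq0 t htI) (mul_nonneg hM (hε n).le)) h1).trans ?_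
        have : M * ε n ≤ M * 1 := mul_le_mul_of_nonneg_left (hε1 n) hM
        linarith [hqQ t htI]
      have h3 := (abs_le.1 (hkM t htI)).2
      simp only [mul_one]
      linarith
  have hZlower : ∀ a b : ℝ, 0 < a → b < r → ∃ m > 0, ∀ n, ∀ s ∈ Icc a b, m ≤ Z n s := by
    intro a b ha hb
    rcases lt_or_ge b a with hba | hab
    · exact ⟨1, one_pos, fun n s hs => absurd (hs.1.trans hs.2) (not_le.2 hba)⟩
    have hsub : Icc (a / 2) b ⊆ Ioo 0 r := fun s hs =>
      ⟨(half_pos ha).trans_le hs.1, hs.2.trans_lt hb⟩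
    have hsub' := hsub.trans Ioo_subset_Icc_self
    obtain ⟨s₀, hs₀, hmin⟩ := (isCompact_Icc (a := a / 2) (b := b)).exists_isMinOn
      ⟨b, by linarith, le_rfl⟩ (hq.mono hsub')
    have hq₀ : 0 < q s₀ := hqpos s₀ (hsub hs₀)
    -- The barrier is the line `δ * (s - a / 2)`. Below it `Z n ≤ δ * r`, so by the choice of `δ`
    -- the quotient is at least `1 + M` and the slope of `Z n` at least `1 ≥ δ`.
    let δ : ℝ := min 1 (q s₀ / (r * (1 + M)))
    have hδ : 0 < δ := lt_min one_pos (by positivity)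
    have hδ1 : δ ≤ 1 := min_le_left _ _
    have hδ2 : δ * (r * (1 + M)) ≤ q s₀ := (le_div_iff₀ (by positivity)).1 (min_le_right _ _)
    refine ⟨δ * (a / 2), by positivity, fun n s hs => ?_⟩
    have := nonpos_of_deriv_nonpos_of_pos (u := fun s => δ * (s - a / 2) - Z n s)
      (a := a / 2) (b := b) (ContinuousOn.sub (by fun_prop) ((hZc n).mono hsub')) ?_ ?_ s
      ⟨by linarith [hs.1], hs.2⟩
    · have : δ * (a / 2) ≤ δ * (s - a / 2) := mul_le_mul_of_nonneg_left (by linarith [hs.1]) hδ.le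
      linarith
    · simpa using (hZpos n _ (hsub' ⟨le_rfl, by linarith⟩)).le
    · intro t ht hpos
      have htI := hsub' (Ioo_subset_Icc_self ht)
      have htI' := hsub (Ioo_subset_Icc_self ht)
      refine ⟨_, ?_, (((hasDerivAt_id t).sub_const (a / 2)).const_mul δ).sub (hZd n t htI')⟩
      have hZt := hZpos n t htI
      have h1 : Z n t ≤ δ * r := by
        have : δ * (t - a / 2) ≤ δ * r := mul_le_mul_of_nonneg_left (by linarith [htI.2]) hδ.le
        linarith
      have h2 : 1 + M ≤ (q t + M * ε n) / Z n t := by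
        rw [le_div_iff₀ hZt]
        have h3 : q s₀ ≤ q t := hmin (Ioo_subset_Icc_self ht)
        have h4 : (1 + M) * Z n t ≤ (1 + M) * (δ * r) := mul_le_mul_of_nonneg_left h1 (by positivity)
        have h5 : 0 ≤ M * ε n := mul_nonneg hM (hε n).le
        nlinarith
      have h3 := (abs_le.1 (hkM t htI)).1
      simp only [mul_one]
      linarith
  let z : ℝ → ℝ := fun s => ⨅ n, Z n s
  have hbdd : ∀ s ∈ Icc 0 r, BddBelow (range fun n => Z n s) := fun s hs =>
    ⟨0, by rintro _ ⟨n, rfl⟩; exact (hZpos n s hs).le⟩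
  have hlim : ∀ s ∈ Icc 0 r, Tendsto (fun n => Z n s) atTop (𝓝 (z s)) := fun s hs =>
    tendsto_atTop_ciInf (hZanti s hs) (hbdd s hs)
  have hzle : ∀ n, ∀ s ∈ Icc 0 r, z s ≤ Z n s := fun n s hs => ciInf_le (hbdd s hs) n
  have hz0 : z 0 = 0 := by
    refine tendsto_nhds_unique (hlim 0 h0mem) ?_
    simpa only [hZ0] using hεlim
  have hznonneg : ∀ s ∈ Icc 0 r, 0 ≤ z s := fun s hs => le_ciInf fun n => (hZpos n s hs).le
  have hzlow : ∀ a b : ℝ, 0 < a → b < r → ∃ m > 0, (∀ n, ∀ s ∈ Icc a b, m ≤ Z n s) ∧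
      ∀ s ∈ Icc a b, m ≤ z s := by
    intro a b ha hb
    obtain ⟨m, hm, h⟩ := hZlower a b ha hb
    exact ⟨m, hm, h, fun s hs => le_ciInf fun n => h n s hs⟩
  have hzd : ∀ s ∈ Ioo 0 r, HasDerivAt z (k s + q s / z s) s := by
    intro s hs
    obtain ⟨a, ha0, has⟩ := exists_between hs.1
    obtain ⟨b, hsb, hbr⟩ := exists_between hs.2
    have hsub : Icc a b ⊆ Ioo 0 r := fun t ht => ⟨ha0.trans_le ht.1, ht.2.trans_lt hbr⟩
    have hsub' : Icc a b ⊆ Icc 0 r := hsub.trans Ioo_subset_Icc_self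
    obtain ⟨m, hm, hmZ, hmz⟩ := hzlow a b ha0 hbr
    have hFn : ∀ n, ContinuousOn (fun t => k t + (q t + M * ε n) / Z n t) (Icc a b) := fun n =>
      (hk.mono hsub').add (((hq.mono hsub').add continuousOn_const).div ((hZc n).mono hsub')
        fun t ht => (hZpos n t (hsub' ht)).ne')
    -- The limit is first taken in the integrated equation, dominated thanks to the uniform lower
    -- bound `m`. Continuity of `z`, and then the differential equation, follow from the integral
    -- form.
    have hint : ∀ t ∈ Icc a b, z t - z a = ∫ x in a..t, (k x + q x / z x) := by
      intro t ht
      have hu : uIoc a t ⊆ Icc a b := by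
        rw [uIoc_of_le ht.1]
        exact fun x hx => ⟨hx.1.le, hx.2.trans ht.2⟩
      have hut : uIcc a t ⊆ Icc a b := by
        rw [uIcc_of_le ht.1]
        exact Icc_subset_Icc_right ht.2
      have h1 : Tendsto (fun n => ∫ x in a..t, (k x + (q x + M * ε n) / Z n x)) atTop
          (𝓝 (∫ x in a..t, (k x + q x / z x))) := by
        refine intervalIntegral.tendsto_integral_filter_of_dominated_convergence
          (fun _ => M + (Q + M) / m) ?_ ?_ ?_ ?_
        · refine Eventually.of_forall fun n => ?_
          exact ((hFn n).mono hu).aestronglyMeasurable measurableSet_uIoc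
        · refine Eventually.of_forall fun n => Eventually.of_forall fun x hx => ?_
          have hxI := hsub' (hu hx)
          have h2 : 0 ≤ q x + M * ε n := add_nonneg (hq0 x hxI) (mul_nonneg hM (hε n).le)
          refine (abs_add_le _ _).trans (add_le_add (hkM x hxI) ?_)
          rw [abs_of_nonneg (div_nonneg h2 (hZpos n x hxI).le)]
          have : M * ε n ≤ M * 1 := mul_le_mul_of_nonneg_left (hε1 n) hM
          exact div_le_div₀ (by positivity) (by linarith [hqQ x hxI]) hm (hmZ n x (hu hx))
        · exact intervalIntegrable_const
        · refine Eventually.of_forall fun x hx => ?_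
          have hz : z x ≠ 0 := (hm.trans_le (hmz x (hu hx))).ne'
          have := ((hεlim.const_mul M).const_add (q x)).div (hlim x (hsub' (hu hx))) hz
          simpa using this.const_add (k x)
      have h2 : ∀ n, ∫ x in a..t, (k x + (q x + M * ε n) / Z n x) = Z n t - Z n a := fun n =>
        intervalIntegral.integral_eq_sub_of_hasDerivAt
          (fun x hx => hZd n x (hsub (hut hx))) ((hFn n).mono hut).intervalIntegrable
      simp only [h2] at h1
      exact tendsto_nhds_unique
        ((hlim t (hsub' ht)).sub (hlim a (hsub' ⟨le_rfl, has.le.trans hsb.le⟩))) h1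
    have hmeas : AEStronglyMeasurable z (volume.restrict (Icc a b)) := by
      refine aestronglyMeasurable_of_tendsto_ae atTop
        (fun n => ((hZc n).mono hsub').aestronglyMeasurable measurableSet_Icc) ?_
      exact (ae_restrict_iff' measurableSet_Icc).2
        (Eventually.of_forall fun x hx => hlim x (hsub' hx))
    have hInt : IntegrableOn (fun x => k x + q x / z x) (Icc a b) volume := by
      refine Integrable.of_bound (C := M + Q / m) ?_ ?_
      · exact ((hk.mono hsub').aestronglyMeasurable measurableSet_Icc).add
          (((hq.mono hsub').aestronglyMeasurable measurableSet_Icc).aemeasurable.div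
            hmeas.aemeasurable).aestronglyMeasurable
      · refine (ae_restrict_iff' measurableSet_Icc).2 (Eventually.of_forall fun x hx => ?_)
        have hxI := hsub' hx
        refine (abs_add_le _ _).trans (add_le_add (hkM x hxI) ?_)
        rw [abs_of_nonneg (div_nonneg (hq0 x hxI) (hznonneg x hxI))]
        exact div_le_div₀ hQ (hqQ x hxI) hm (hmz x hx)
    have hzc : ContinuousOn z (Icc a b) := by
      have hc := intervalIntegral.continuousOn_primitive_interval (a := a) (b := b)
        (f := fun x => k x + q x / z x) (μ := volume)
        (by rwa [uIcc_of_le (has.le.trans hsb.le)])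
      rw [uIcc_of_le (has.le.trans hsb.le)] at hc
      refine (hc.add (continuousOn_const (c := z a))).congr fun t ht => ?_
      rw [Pi.add_apply, ← hint t ht]
      ring
    have hvc : ContinuousOn (fun x => k x + q x / z x) (Ioo a b) :=
      ((hk.mono hsub').add ((hq.mono hsub').div hzc
        fun t ht => (hm.trans_le (hmz t ht)).ne')).mono Ioo_subset_Icc_self
    have hd : HasDerivAt (fun t => z s + ∫ x in s..t, (k x + q x / z x)) (k s + q s / z s) s :=
      (hasDerivAt_primitive isOpen_Ioo ordConnected_Ioo hvc ⟨has, hsb⟩ ⟨has, hsb⟩).const_add _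
    refine hd.congr_of_eventuallyEq ?_
    filter_upwards [Icc_mem_nhds has hsb] with t ht
    have hs' : s ∈ Icc a b := ⟨has.le, hsb.le⟩
    have hii : ∀ y ∈ Icc a b, IntervalIntegrable (fun x => k x + q x / z x) volume a y :=
      fun y hy => (intervalIntegrable_iff_integrableOn_Icc_of_le hy.1).2
        (hInt.mono_set (Icc_subset_Icc_right hy.2))
    have h1 := intervalIntegral.integral_add_adjacent_intervals (hii s hs')
      ((hii s hs').symm.trans (hii t ht))
    rw [← hint t ht, ← hint s hs'] at h1
    linarith
  refine ⟨z, hz0, ?_, ?_, hzd, 1 + (2 * M + Q) * r, fun s hs => ?_⟩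
  · intro s hs
    rcases hs.1.eq_or_lt with rfl | hs0
    · rw [ContinuousWithinAt, hz0]
      refine Metric.tendsto_nhdsWithin_nhds.2 fun e he => ?_
      -- Near `0` the limit is squeezed between `0` and one approximation with small initial value.
      obtain ⟨n, hn⟩ := (hεlim.eventually (gt_mem_nhds (half_pos he))).exists
      have hc := (hZc n) 0 h0mem
      obtain ⟨d, hd, hdd⟩ := Metric.continuousWithinAt_iff.1 hc (e / 2) (half_pos he)
      refine ⟨d, hd, fun x hx hxd => ?_⟩
      have hxI : x ∈ Icc 0 r := Ico_subset_Icc_self hx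
      have h1 := hdd hxI hxd
      rw [Real.dist_eq, hZ0] at h1
      rw [Real.dist_eq, sub_zero, abs_of_nonneg (hznonneg x hxI)]
      have := (abs_lt.1 h1).2
      linarith [hzle n x hxI]
    · exact (hzd s ⟨hs0, hs.2⟩).continuousAt.continuousWithinAt
  · intro s hs
    obtain ⟨m, hm, -, h⟩ := hzlow s s hs.1 hs.2
    exact hm.trans_le (h s ⟨le_rfl, le_rfl⟩)
  · exact (hzle 0 s (Ioo_subset_Icc_self hs)).trans (hZupper 0 s (Ioo_subset_Icc_self hs))

theorem _root_.AbsolutelyContinuousOnInterval.congr_of_eqOn {F G : ℝ → ℝ} {a b : ℝ}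
    (hF : AbsolutelyContinuousOnInterval F a b) (h : EqOn G F (uIcc a b)) :
    AbsolutelyContinuousOnInterval G a b := by
  rw [absolutelyContinuousOnInterval_iff] at hF ⊢
  intro ε hε
  obtain ⟨δ, hδ, H⟩ := hF ε hε
  refine ⟨δ, hδ, fun E hE hlt => ?_⟩
  convert H E hE hlt using 1
  refine Finset.sum_congr rfl fun i hi => ?_
  rw [h (hE.1 i hi).1, h (hE.1 i hi).2]

/-! ### Profiles from solutions of the first order problem -/

/-- `φ` is an increasing solution of `φ' = z(φ) / D(φ)` on `(-∞, b)`, extended by zero, that takes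
all values of `(0, r)`. -/
structure IsProfile (r : ℝ) (D z : ℝ → ℝ) (b : ℝ) (φ : ℝ → ℝ) : Prop where
  mem_Ico : ∀ ξ < b, φ ξ ∈ Ico 0 r
  continuousOn : ContinuousOn φ (Iio b)
  monotoneOn : MonotoneOn φ (Iio b)
  hasDerivAt : ∀ ξ < b, 0 < φ ξ → HasDerivAt φ (z (φ ξ) / D (φ ξ)) ξ
  tendsto : Tendsto φ atBot (𝓝 0)
  surjective : ∀ s ∈ Ioo 0 r, ∃ ξ < b, φ ξ = s

/-- The inverse of a strictly increasing function on `(0, r)` that is bounded above, extended by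
zero to the left. -/
theorem exists_inverse_extended_by_zero {r : ℝ} {T : ℝ → ℝ} (hr : 0 < r)
    (hT : StrictMonoOn T (Ioo 0 r)) (hTc : ContinuousOn T (Ioo 0 r))
    (hTb : BddAbove (T '' Ioo 0 r)) :
    ∃ (b : ℝ) (φ : ℝ → ℝ), (∀ s ∈ Ioo 0 r, T s < b ∧ φ (T s) = s) ∧
      (∀ ξ < b, φ ξ ∈ Ico 0 r) ∧ ContinuousOn φ (Iio b) ∧ MonotoneOn φ (Iio b) ∧
      Tendsto φ atBot (𝓝 0) ∧ ∀ ξ < b, 0 < φ ξ → T (φ ξ) = ξ := by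
  classical
  have hne : (T '' Ioo 0 r).Nonempty := ⟨T (r / 2), r / 2, ⟨by linarith, by linarith⟩, rfl⟩
  set b := sSup (T '' Ioo 0 r) with hb
  have hlt : ∀ s ∈ Ioo 0 r, T s < b := by
    intro s hs
    obtain ⟨t, hst, htr⟩ := exists_between hs.2
    have ht : t ∈ Ioo 0 r := ⟨hs.1.trans hst, htr⟩
    exact (hT hs ht hst).trans_le (le_csSup hTb ⟨t, ht, rfl⟩)
  -- The range of `T` is an interval reaching up to `b`, so a point below `b` outside the range lies
  -- to the left of all of it; the default value `0` of `φ` is used only there.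
  have hsurj : ∀ ξ < b, ∀ s ∈ Ioo 0 r, T s ≤ ξ → ∃ t ∈ Ioo 0 r, T t = ξ := by
    intro ξ hξ s hs hsξ
    obtain ⟨_, ⟨t, ht, rfl⟩, hξt⟩ := exists_lt_of_lt_csSup hne hξ
    exact (isPreconnected_Ioo.image T hTc).ordConnected.out ⟨s, hs, rfl⟩ ⟨t, ht, rfl⟩
      ⟨hsξ, hξt.le⟩
  let φ : ℝ → ℝ := fun ξ => if h : ∃ s ∈ Ioo 0 r, T s = ξ then h.choose else 0
  have hφT : ∀ s ∈ Ioo 0 r, φ (T s) = s := by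
    intro s hs
    have h : ∃ t ∈ Ioo 0 r, T t = T s := ⟨s, hs, rfl⟩
    have h1 : φ (T s) = h.choose := dif_pos h
    rw [h1]
    exact hT.injOn h.choose_spec.1 hs h.choose_spec.2
  have hφ0 : ∀ ξ, (¬ ∃ s ∈ Ioo 0 r, T s = ξ) → φ ξ = 0 := fun ξ h => dif_neg h
  have hmem : ∀ ξ, φ ξ ∈ Ico 0 r := by
    intro ξ
    by_cases h : ∃ s ∈ Ioo 0 r, T s = ξ
    · obtain ⟨s, hs, rfl⟩ := h
      rw [hφT s hs]
      exact Ioo_subset_Ico_self hs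
    · rw [hφ0 ξ h]
      exact ⟨le_rfl, hr⟩
  have hTφ : ∀ ξ, 0 < φ ξ → T (φ ξ) = ξ := by
    intro ξ hξ
    by_cases h : ∃ s ∈ Ioo 0 r, T s = ξ
    · obtain ⟨s, hs, rfl⟩ := h
      rw [hφT s hs]
    · rw [hφ0 ξ h] at hξ
      exact absurd hξ (lt_irrefl _)
  have hmono : MonotoneOn φ (Iio b) := by
    intro x hx y hy hxy
    rcases (hmem x).1.eq_or_lt with h | h
    · rw [← h]
      exact (hmem y).1
    · have hs : φ x ∈ Ioo 0 r := ⟨h, (hmem x).2⟩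
      obtain ⟨t, ht, rfl⟩ := hsurj y hy (φ x) hs ((hTφ x h).trans_le hxy)
      rw [hφT t ht]
      rw [← hTφ x h] at hxy
      exact (hT.le_iff_le hs ht).1 hxy
  have hsmall : ∀ s ∈ Ioo 0 r, ∀ ξ ≤ T s, φ ξ ≤ s := by
    intro s hs ξ hξ
    have := hmono (hξ.trans_lt (hlt s hs)) (hlt s hs) hξ
    rwa [hφT s hs] at this
  refine ⟨b, φ, fun s hs => ⟨hlt s hs, hφT s hs⟩, fun ξ _ => hmem ξ, ?_, hmono, ?_,
    fun ξ _ => hTφ ξ⟩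
  · intro ξ hξ
    refine ContinuousAt.continuousWithinAt ?_
    rcases (hmem ξ).1.eq_or_lt with h | h
    · rw [ContinuousAt, ← h]
      refine tendsto_order.2 ⟨fun a ha => Eventually.of_forall fun y => ha.trans_le (hmem y).1,
        fun a ha => ?_⟩
      obtain ⟨s, hs0, hs1⟩ := exists_between (lt_min ha hr)
      have hs : s ∈ Ioo 0 r := ⟨hs0, hs1.trans_le (min_le_right _ _)⟩
      have hξT : ξ < T s := by
        by_contra! hle
        have := hmono (hlt s hs) hξ hle
        rw [hφT s hs, ← h] at this
        exact absurd this (not_le.2 hs0)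
      filter_upwards [Iio_mem_nhds hξT] with y hy
      exact (hsmall s hs y (le_of_lt hy)).trans_lt (hs1.trans_le (min_le_left _ _))
    · refine continuousAt_of_monotoneOn_of_image_mem_nhds hmono (Iio_mem_nhds hξ) ?_
      refine mem_of_superset (Ioo_mem_nhds h (hmem ξ).2) fun s hs => ?_
      exact ⟨T s, hlt s hs, hφT s hs⟩
  · refine tendsto_order.2 ⟨fun a ha => Eventually.of_forall fun y => ha.trans_le (hmem y).1,
      fun a ha => ?_⟩
    obtain ⟨s, hs0, hs1⟩ := exists_between (lt_min ha hr)
    have hs : s ∈ Ioo 0 r := ⟨hs0, hs1.trans_le (min_le_right _ _)⟩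
    filter_upwards [Iic_mem_atBot (T s)] with y hy
    exact (hsmall s hs y hy).trans_lt (hs1.trans_le (min_le_left _ _))

section

variable {r c : ℝ} {f D g : ℝ → ℝ}

theorem IsData.continuousOn_dot (hr : 0 < r) (hd : IsData r f D g) :
    ContinuousOn (dot r f) (Icc 0 r) :=
  hd.f_contDiffOn.continuousOn_derivWithin (uniqueDiffOn_Icc hr) le_rfl

theorem IsData.hasDerivWithinAt (hd : IsData r f D g) {s : ℝ} (hs : s ∈ Icc 0 r) :
    HasDerivWithinAt f (dot r f s) (Icc 0 r) s :=
  ((hd.f_contDiffOn.differentiableOn one_ne_zero) s hs).hasDerivWithinAt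

theorem IsData.hasDerivAt (hd : IsData r f D g) {s : ℝ} (hs : s ∈ Ioo 0 r) :
    HasDerivAt f (dot r f s) s :=
  (hd.hasDerivWithinAt (Ioo_subset_Icc_self hs)).hasDerivAt (Icc_mem_nhds hs.1 hs.2)

/-- The right-hand side `h - c` of the first order problem. -/
noncomputable def rate (r : ℝ) (f : ℝ → ℝ) (c s : ℝ) : ℝ := dot r f s - c

/-- The coefficient `-D g` of the first order problem. -/
def reaction (D g : ℝ → ℝ) (s : ℝ) : ℝ := -(D s * g s)

theorem DHat.nonneg (hr : 0 < r) (hd : IsData r f D g) (hD : DHat r D) :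
    ∀ s ∈ Icc 0 r, 0 ≤ D s := by
  intro s hs
  rw [← closure_Ioo hr.ne] at hs
  have hcont : ContinuousOn D (closure (Ioo 0 r)) := by
    rw [closure_Ioo hr.ne]
    exact hd.D_contDiffOn.continuousOn
  have := hcont.image_closure (mem_image_of_mem D hs)
  refine closure_minimal ?_ isClosed_Ici this
  rintro _ ⟨t, ht, rfl⟩
  exact (hD t ht).le

theorem GHat.nonpos (hg : GHat r g) : ∀ s ∈ Icc 0 r, g s ≤ 0 := by
  intro s hs
  rcases hs.1.eq_or_lt with rfl | h
  · exact hg.2.le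
  · exact (hg.1 s ⟨h, hs.2⟩).le

/-- A semi-wavefront profile exists for every solution of the first order problem. -/
theorem exists_isProfile {z : ℝ → ℝ} (hr : 0 < r) (hd : IsData r f D g) (hD : DHat r D)
    (hg : GHat r g) (hz : IsFirstOrderSol r (rate r f c) (reaction D g) z) :
    ∃ (b : ℝ) (φ T : ℝ → ℝ), IsProfile r D z b φ ∧
      ∀ s ∈ Ioo 0 r, HasDerivAt T (D s / z s) s ∧ T s < b ∧ φ (T s) = s := by
  have hm : r / 2 ∈ Ioo 0 r := ⟨by linarith, by linarith⟩
  have hv : ContinuousOn (fun s => D s / z s) (Ioo 0 r) :=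
    (hd.D_contDiffOn.continuousOn.mono Ioo_subset_Icc_self).div
      (hz.continuousOn.mono Ioo_subset_Ico_self) fun s hs => (hz.pos s hs).ne'
  -- `T s` is the position at which the wave has the value `s`; the base point `r / 2` fixes the
  -- shift.
  set T : ℝ → ℝ := fun s => ∫ t in (r / 2)..s, D t / z t with hTdef
  have hTd : ∀ s ∈ Ioo 0 r, HasDerivAt T (D s / z s) s := fun s hs =>
    hasDerivAt_primitive isOpen_Ioo ordConnected_Ioo hv hm hs
  have hTc : ContinuousOn T (Ioo 0 r) := fun s hs => (hTd s hs).continuousAt.continuousWithinAt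
  have hTm : StrictMonoOn T (Ioo 0 r) := by
    refine strictMonoOn_of_deriv_pos (convex_Ioo 0 r) hTc fun s hs => ?_
    rw [interior_Ioo] at hs
    rw [(hTd s hs).deriv]
    exact div_pos (hD s hs) (hz.pos s hs)
  have hTb : BddAbove (T '' Ioo 0 r) := by
    obtain ⟨M, hM⟩ := isCompact_Icc.exists_bound_of_continuousOn
      ((hd.continuousOn_dot hr).sub (continuousOn_const (c := c)))
    simp only [Pi.sub_apply, Real.norm_eq_abs] at hM
    obtain ⟨B, hB⟩ := hz.bddAbove
    have hsub : Icc (r / 2) r ⊆ Icc 0 r := Icc_subset_Icc_left hm.1.le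
    obtain ⟨s₀, hs₀, hmax⟩ := (isCompact_Icc (a := r / 2) (b := r)).exists_isMaxOn
      ⟨r, hm.2.le, le_rfl⟩ (hd.g_continuousOn.mono hsub)
    have hg₀ : 0 < -g s₀ := neg_pos.2 (hg.1 s₀ ⟨hm.1.trans_le hs₀.1, hs₀.2⟩)
    set γ := -g s₀
    have hM0 : 0 ≤ M := (abs_nonneg _).trans (hM r ⟨hr.le, le_rfl⟩)
    have hsub' : Ico (r / 2) r ⊆ Ioo 0 r := fun s hs => ⟨hm.1.trans_le hs.1, hs.2⟩
    -- On `[r / 2, r)` one has `γ ≤ -g`, hence `γ * T' ≤ -D g / z = z' - (h - c) ≤ z' + M`.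
    -- Integration bounds `T` by means of the bound of `z`.
    have hder : ∀ s ∈ Ico (r / 2) r, HasDerivAt (fun s => γ * T s - (z s + M * s))
        (γ * (D s / z s) - (rate r f c s + reaction D g s / z s + M * 1)) s := fun s hs =>
      ((hTd s (hsub' hs)).const_mul γ).sub ((hz.hasDerivAt s (hsub' hs)).add
        ((hasDerivAt_id s).const_mul M))
    have hanti : AntitoneOn (fun s => γ * T s - (z s + M * s)) (Ico (r / 2) r) := by
      refine antitoneOn_of_deriv_nonpos (convex_Ico _ _)
        (fun s hs => (hder s hs).continuousAt.continuousWithinAt)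
        (fun s hs => (hder s (interior_subset hs)).differentiableAt.differentiableWithinAt) ?_
      intro s hs
      have hs' := interior_subset hs
      rw [(hder s hs').deriv]
      have hsI := hsub' hs'
      have h1 : γ * (D s / z s) ≤ reaction D g s / z s := by
        rw [← mul_div_assoc]
        refine div_le_div_of_nonneg_right ?_ (hz.pos s hsI).le
        have h2 : g s ≤ g s₀ := hmax ⟨hs'.1, hs'.2.le⟩
        have := mul_le_mul_of_nonneg_left h2 (hD s hsI).le
        simp only [reaction, γ]
        linarith
      have h2 := (abs_le.1 (hM s (Ioo_subset_Icc_self hsI))).1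
      have h3 : rate r f c s = dot r f s - c := rfl
      linarith
    refine ⟨(B + M * r) / γ, ?_⟩
    have hT0 : T (r / 2) = 0 := intervalIntegral.integral_same
    rintro _ ⟨s, hs, rfl⟩
    rw [le_div_iff₀ hg₀]
    rcases le_total s (r / 2) with h | h
    · have h1 : T s ≤ 0 := by
        rw [← hT0]
        exact hTm.monotoneOn hs hm h
      have h2 : 0 ≤ B := (hz.pos s hs).le.trans (hB s hs)
      have h3 : T s * γ ≤ 0 := mul_nonpos_of_nonpos_of_nonneg h1 hg₀.le
      have h4 : 0 ≤ M * r := by positivity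
      linarith
    · have h1 := hanti ⟨le_rfl, hm.2⟩ ⟨h, hs.2⟩ h
      simp only [hT0] at h1
      have h2 : M * s ≤ M * r := mul_le_mul_of_nonneg_left hs.2.le hM0
      have h3 : 0 ≤ M * (r / 2) := mul_nonneg hM0 hm.1.le
      linarith [hB s hs, hz.pos _ hm]
  obtain ⟨b, φ, h1, h2, h3, h4, h5, h6⟩ := exists_inverse_extended_by_zero hr hTm hTc hTb
  refine ⟨b, φ, T, ⟨h2, h3, h4, ?_, h5, fun s hs => ⟨T s, h1 s hs⟩⟩, fun s hs =>
    ⟨hTd s hs, h1 s hs⟩⟩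
  intro ξ hξ hpos
  have hs : φ ξ ∈ Ioo 0 r := ⟨hpos, (h2 ξ hξ).2⟩
  have hcont : ContinuousAt φ ξ := h3.continuousAt (Iio_mem_nhds hξ)
  have := HasDerivAt.of_local_left_inverse hcont (hTd _ hs)
    (div_pos (hD _ hs) (hz.pos _ hs)).ne' ?_
  · rwa [inv_div] at this
  · filter_upwards [Iio_mem_nhds hξ, hcont.eventually (lt_mem_nhds hpos)] with y hy hy'
    exact h6 y hy hy'

/-! ### The zero set of a monotone profile -/

/-- A nonnegative continuous monotone function on `(-∞, b)` with a positive value is either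
positive or vanishes exactly on a half line. -/
theorem pos_or_exists_zero_set {b : ℝ} {φ : ℝ → ℝ} (hnonneg : ∀ ξ < b, 0 ≤ φ ξ)
    (hcont : ContinuousOn φ (Iio b)) (hmono : MonotoneOn φ (Iio b)) (hpos : ∃ ξ < b, 0 < φ ξ) :
    (∀ ξ < b, 0 < φ ξ) ∨
      ∃ A < b, (∀ ξ ≤ A, φ ξ = 0) ∧ ∀ ξ ∈ Ioo A b, 0 < φ ξ := by
  by_cases h : ∀ ξ < b, 0 < φ ξ
  · exact Or.inl h
  right
  push Not at h
  obtain ⟨ξ₀, hξ₀, h0⟩ := h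
  obtain ⟨ξ₁, hξ₁, h1⟩ := hpos
  let Z : Set ℝ := {ξ | ξ < b ∧ φ ξ ≤ 0}
  have hub : ∀ ξ ∈ Z, ξ ≤ ξ₁ := by
    intro ξ hξ
    by_contra! hlt
    exact absurd (hmono hξ₁ hξ.1 hlt.le) (not_le.2 (hξ.2.trans_lt h1))
  have hbdd : BddAbove Z := ⟨ξ₁, hub⟩
  have hne : Z.Nonempty := ⟨ξ₀, hξ₀, h0⟩
  have hAb : sSup Z < b := (csSup_le hne hub).trans_lt hξ₁
  have hlt : ∀ ξ < sSup Z, φ ξ = 0 := by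
    intro ξ hξ
    obtain ⟨y, hy, hξy⟩ := exists_lt_of_lt_csSup hne hξ
    exact le_antisymm ((hmono (hξy.trans hy.1) hy.1 hξy.le).trans hy.2)
      (hnonneg ξ (hξ.trans hAb))
  refine ⟨sSup Z, hAb, fun ξ hξ => ?_, fun ξ hξ => ?_⟩
  · rcases hξ.eq_or_lt with rfl | hξ
    · have hc : Tendsto φ (𝓝[<] (sSup Z)) (𝓝 (φ (sSup Z))) :=
        (hcont.continuousAt (Iio_mem_nhds hAb)).continuousWithinAt
      refine tendsto_nhds_unique hc (tendsto_const_nhds.congr' ?_)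
      filter_upwards [self_mem_nhdsWithin] with y hy
      exact (hlt y hy).symm
    · exact hlt ξ hξ
  · by_contra! hle
    exact absurd (le_csSup hbdd (show ξ ∈ Z from ⟨hξ.2, hle⟩)) (not_le.2 hξ.1)

/-- If the derivative exists, it equals the left derivative, which is `0`; otherwise `deriv` takes
its default value `0`. Thus the flux is `0` at the point where a wave leaves zero, even if the wave
has a corner there. -/
theorem deriv_eq_zero_of_eq_zero_left {φ : ℝ → ℝ} {ξ : ℝ} (h : ∀ y ≤ ξ, φ y = 0) :
    deriv φ ξ = 0 := by
  by_cases hd : DifferentiableAt ℝ φ ξ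
  · have h1 : HasDerivWithinAt φ (deriv φ ξ) (Iic ξ) ξ := hd.hasDerivAt.hasDerivWithinAt
    have h2 : HasDerivWithinAt φ 0 (Iic ξ) ξ :=
      (hasDerivWithinAt_const ξ (Iic ξ) (0 : ℝ)).congr (fun y hy => h y hy) (h ξ le_rfl)
    exact (uniqueDiffWithinAt_Iic ξ).eq_deriv _ h1 h2
  · exact deriv_zero_of_not_differentiableAt hd

namespace IsProfile

variable {z : ℝ → ℝ} {b : ℝ} {φ : ℝ → ℝ}

theorem exists_pos (hr : 0 < r) (hφ : IsProfile r D z b φ) : ∃ ξ < b, 0 < φ ξ := by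
  obtain ⟨ξ, hξ, h⟩ := hφ.surjective (r / 2) ⟨by linarith, by linarith⟩
  exact ⟨ξ, hξ, by rw [h]; linarith⟩

theorem pos_or_exists (hr : 0 < r) (hφ : IsProfile r D z b φ) :
    (∀ ξ < b, 0 < φ ξ) ∨ ∃ A < b, (∀ ξ ≤ A, φ ξ = 0) ∧ ∀ ξ ∈ Ioo A b, 0 < φ ξ :=
  pos_or_exists_zero_set (fun ξ hξ => (hφ.mem_Ico ξ hξ).1) hφ.continuousOn hφ.monotoneOn
    (hφ.exists_pos hr)

theorem eq_zero_of_le (hφ : IsProfile r D z b φ) {ξ y : ℝ} (hξ : ξ < b) (h0 : φ ξ = 0)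
    (hy : y ≤ ξ) : φ y = 0 := by
  refine le_antisymm ?_ (hφ.mem_Ico y (hy.trans_lt hξ)).1
  rw [← h0]
  exact hφ.monotoneOn (hy.trans_lt hξ) hξ hy

theorem continuousAt (hφ : IsProfile r D z b φ) {ξ : ℝ} (hξ : ξ < b) : ContinuousAt φ ξ :=
  hφ.continuousOn.continuousAt (Iio_mem_nhds hξ)

theorem continuousAt_comp (hφ : IsProfile r D z b φ) {F : ℝ → ℝ} (hF : ContinuousOn F (Ico 0 r))
    {ξ : ℝ} (hξ : ξ < b) : ContinuousAt (fun ξ => F (φ ξ)) ξ :=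
  (hF.comp hφ.continuousOn fun y hy => hφ.mem_Ico y hy).continuousAt (Iio_mem_nhds hξ)

/-- The only point that can escape both alternatives is the right end of the zero set, and a
punctured neighbourhood can avoid it. -/
theorem eventually_pos_or_eq_zero (hr : 0 < r) (hφ : IsProfile r D z b φ) {ξ : ℝ} (hξ : ξ < b) :
    ∀ᶠ y in 𝓝[≠] ξ, y < b ∧ (0 < φ y ∨ φ =ᶠ[𝓝 y] fun _ => 0) := by
  have hb : ∀ᶠ y in 𝓝[≠] ξ, y < b := mem_nhdsWithin_of_mem_nhds (Iio_mem_nhds hξ)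
  rcases hφ.pos_or_exists hr with h | ⟨A, hA, h0, hpos⟩
  · filter_upwards [hb] with y hy using ⟨hy, Or.inl (h y hy)⟩
  · have hne : ∀ᶠ y in 𝓝[≠] ξ, y ≠ A := by
      rcases eq_or_ne ξ A with rfl | hne
      · exact self_mem_nhdsWithin
      · exact mem_nhdsWithin_of_mem_nhds (isOpen_ne.mem_nhds hne)
    filter_upwards [hb, hne] with y hy hyA
    refine ⟨hy, ?_⟩
    rcases hyA.lt_or_gt with h | h
    · right
      filter_upwards [Iio_mem_nhds h] with x hx using h0 x (le_of_lt hx)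
    · exact Or.inl (hpos y ⟨h, hy⟩)

/-- The chain rule along a profile, including the point where it leaves zero. -/
theorem hasDerivAt_comp (hr : 0 < r) (hφ : IsProfile r D z b φ) {F F' G : ℝ → ℝ}
    (hF : ContinuousOn F (Ico 0 r)) (hG : ContinuousOn G (Ico 0 r)) (hG0 : G 0 = 0)
    (hF' : ∀ s ∈ Ioo 0 r, HasDerivAt F (F' s) s)
    (hFG : ∀ s ∈ Ioo 0 r, F' s * (z s / D s) = G s) {ξ : ℝ} (hξ : ξ < b) :
    HasDerivAt (fun ξ => F (φ ξ)) (G (φ ξ)) ξ := by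
  -- Differentiability of `φ` at the exceptional point is not needed: `G ∘ φ` is continuous there,
  -- so the derivative formula extends across it.
  refine hasDerivAt_of_eventually_ne (G := fun ξ => G (φ ξ)) ?_ (hφ.continuousAt_comp hF hξ)
    (hφ.continuousAt_comp hG hξ)
  filter_upwards [hφ.eventually_pos_or_eq_zero hr hξ] with y ⟨hy, h⟩
  rcases h with h | h
  · have hs : φ y ∈ Ioo 0 r := ⟨h, (hφ.mem_Ico y hy).2⟩
    rw [← hFG _ hs]
    exact (hF' _ hs).comp y (hφ.hasDerivAt y hy h)
  · have h1 : (fun ξ => F (φ ξ)) =ᶠ[𝓝 y] fun _ => F 0 := by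
      filter_upwards [h] with x hx
      rw [hx]
    have h2 : φ y = 0 := h.self_of_nhds
    rw [h2, hG0]
    exact (hasDerivAt_const y (F 0)).congr_of_eventuallyEq h1

/-- On the zero set both sides vanish, the left one because `deriv φ` is `0` there in either sense.
-/
theorem diffFlux_eq (hD : DHat r D) (hz0 : z 0 = 0) (hφ : IsProfile r D z b φ) {ξ : ℝ}
    (hξ : ξ < b) : diffFlux D φ ξ = z (φ ξ) := by
  rcases (hφ.mem_Ico ξ hξ).1.eq_or_lt with h | h
  · rw [diffFlux, deriv_eq_zero_of_eq_zero_left fun y hy => hφ.eq_zero_of_le hξ h.symm hy,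
      ← h, hz0, mul_zero]
  · rw [diffFlux, (hφ.hasDerivAt ξ hξ h).deriv,
      mul_div_cancel₀ _ (hD _ ⟨h, (hφ.mem_Ico ξ hξ).2⟩).ne']

end IsProfile

/-! ### The primitive of the diffusivity -/

theorem IsData.hasDerivAt_primitive_D (hd : IsData r f D g) {s : ℝ} (hs : s ∈ Ioo 0 r) :
    HasDerivAt (fun x => ∫ t in (0 : ℝ)..x, D t) (D s) s := by
  have hc := hd.D_contDiffOn.continuousOn
  refine intervalIntegral.integral_hasDerivAt_right ?_ ?_ (hc.continuousAt (Icc_mem_nhds hs.1 hs.2))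
  · refine (hc.mono ?_).intervalIntegrable
    rw [uIcc_of_le hs.1.le]
    exact Icc_subset_Icc_right hs.2.le
  · exact (hc.mono Ioo_subset_Icc_self).stronglyMeasurableAtFilter isOpen_Ioo s hs

theorem IsData.continuousOn_primitive_D (hr : 0 < r) (hd : IsData r f D g) :
    ContinuousOn (fun x => ∫ t in (0 : ℝ)..x, D t) (Icc 0 r) := by
  have := intervalIntegral.continuousOn_primitive_interval (a := 0) (b := r) (f := D)
    (μ := volume) (by
      rw [uIcc_of_le hr.le]
      exact hd.D_contDiffOn.continuousOn.integrableOn_Icc)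
  rwa [uIcc_of_le hr.le] at this

theorem IsData.primitive_D_le (hr : 0 < r) (hd : IsData r f D g) (hD : DHat r D) {s : ℝ}
    (hs : s ∈ Icc 0 r) : ∫ t in (0 : ℝ)..s, D t ≤ ∫ t in (0 : ℝ)..r, D t := by
  have hm : MonotoneOn (fun x => ∫ t in (0 : ℝ)..x, D t) (Icc 0 r) := by
    refine monotoneOn_of_deriv_nonneg (convex_Icc 0 r) (hd.continuousOn_primitive_D hr) ?_ ?_
    · rw [interior_Icc]
      exact fun s hs => (hd.hasDerivAt_primitive_D hs).differentiableAt.differentiableWithinAt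
    · rw [interior_Icc]
      intro s hs
      rw [(hd.hasDerivAt_primitive_D hs).deriv]
      exact (hD s hs).le
  exact hm hs ⟨hr.le, le_rfl⟩ hs.2

/-! ### Profiles are semi-wavefronts -/

namespace IsProfile

variable {z : ℝ → ℝ} {b : ℝ} {φ : ℝ → ℝ}

/-- The equation integrated once. In the derivative of `z - f + c s` the terms `h - c` cancel, and
`(-D g / z) * (z / D) = -g` remains; this extends continuously to `s = 0` because `g 0 = 0`. -/
theorem hasDerivAt_flux (hr : 0 < r) (hd : IsData r f D g) (hD : DHat r D) (hg : GHat r g)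
    (hz : IsFirstOrderSol r (rate r f c) (reaction D g) z) (hφ : IsProfile r D z b φ) {ξ : ℝ}
    (hξ : ξ < b) :
    HasDerivAt (fun ξ => z (φ ξ) - f (φ ξ) + c * φ ξ) (-g (φ ξ)) ξ := by
  refine hφ.hasDerivAt_comp hr (F := fun s => z s - f s + c * s)
    (F' := fun s => rate r f c s + reaction D g s / z s - dot r f s + c * 1)
    (G := fun s => -g s) ?_ (hd.g_continuousOn.mono Ico_subset_Icc_self).neg (by simp [hg.2]) ?_ ?_ hξ
  · exact (hz.continuousOn.sub (hd.f_contDiffOn.continuousOn.mono Ico_subset_Icc_self)).add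
      (by fun_prop)
  · exact fun s hs => ((hz.hasDerivAt s hs).sub (hd.hasDerivAt hs)).add
      ((hasDerivAt_id s).const_mul c)
  · intro s hs
    have h1 := (hz.pos s hs).ne'
    have h2 := (hD s hs).ne'
    simp only [rate, reaction]
    field_simp
    ring

theorem hasDerivAt_primitive_D (hr : 0 < r) (hd : IsData r f D g) (hD : DHat r D)
    (hz : IsFirstOrderSol r (rate r f c) (reaction D g) z) (hφ : IsProfile r D z b φ) {ξ : ℝ}
    (hξ : ξ < b) : HasDerivAt (fun ξ => ∫ s in (0 : ℝ)..φ ξ, D s) (z (φ ξ)) ξ := by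
  refine hφ.hasDerivAt_comp hr (F := fun x => ∫ s in (0 : ℝ)..x, D s) (F' := D) (G := z)
    ((hd.continuousOn_primitive_D hr).mono Ico_subset_Icc_self) hz.continuousOn hz.zero
    (fun s hs => hd.hasDerivAt_primitive_D hs) (fun s hs => ?_) hξ
  exact mul_div_cancel₀ _ (hD s hs).ne'

theorem continuousOn_diffFlux (hD : DHat r D)
    (hz : IsFirstOrderSol r (rate r f c) (reaction D g) z) (hφ : IsProfile r D z b φ) :
    ContinuousOn (diffFlux D φ) (Iio b) :=
  (hz.continuousOn.comp hφ.continuousOn fun y hy => hφ.mem_Ico y hy).congr fun _ hy =>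
    hφ.diffFlux_eq hD hz.zero hy

theorem exists_differentiableAt_of_ne (hr : 0 < r) (hφ : IsProfile r D z b φ) :
    ∃ A, ∀ ξ < b, ξ ≠ A → DifferentiableAt ℝ φ ξ := by
  rcases hφ.pos_or_exists hr with h | ⟨A, hA, h0, hpos⟩
  · exact ⟨0, fun ξ hξ _ => (hφ.hasDerivAt ξ hξ (h ξ hξ)).differentiableAt⟩
  · refine ⟨A, fun ξ hξ hne => ?_⟩
    rcases hne.lt_or_gt with h | h
    · refine (differentiableAt_const (0 : ℝ)).congr_of_eventuallyEq ?_
      filter_upwards [Iio_mem_nhds h] with y hy using h0 y (le_of_lt hy)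
    · exact (hφ.hasDerivAt ξ hξ (hpos ξ ⟨h, hξ⟩)).differentiableAt

theorem isTravelingWave (hr : 0 < r) (hd : IsData r f D g) (hD : DHat r D) (hg : GHat r g)
    (hz : IsFirstOrderSol r (rate r f c) (reaction D g) z) (hφ : IsProfile r D z b φ) :
    IsTravelingWave r f D g c (Iio b) φ where
  isOpen := isOpen_Iio
  ordConnected := ordConnected_Iio
  mapsTo ξ hξ := Ico_subset_Icc_self (hφ.mem_Ico ξ hξ)
  continuousOn := hφ.continuousOn
  ae_differentiableAt := by
    rw [ae_restrict_iff' measurableSet_Iio]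
    obtain ⟨A, hA⟩ := hφ.exists_differentiableAt_of_ne hr
    have : ∀ᵐ ξ : ℝ, ξ ≠ A := by simp [ae_iff]
    filter_upwards [this] with ξ h1 h2 using hA ξ h2 h1
  locallyIntegrableOn := (hφ.continuousOn_diffFlux hD hz).locallyIntegrableOn measurableSet_Iio
  weakDeriv ψ h1 h2 h3 := by
    refine setIntegral_mul_deriv_test isOpen_Iio (fun ξ hξ => ?_)
      (hφ.continuousOn_diffFlux hD hz) h1 h2 h3
    rw [hφ.diffFlux_eq hD hz.zero hξ]
    exact hφ.hasDerivAt_primitive_D hr hd hD hz hξ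
  weakEquation ψ h1 h2 h3 := by
    have hder : ∀ ξ ∈ Iio b, HasDerivAt (fun ξ => diffFlux D φ ξ - f (φ ξ) + c * φ ξ)
        (-g (φ ξ)) ξ := by
      intro ξ hξ
      refine (hφ.hasDerivAt_flux hr hd hD hg hz hξ).congr_of_eventuallyEq ?_
      filter_upwards [Iio_mem_nhds hξ] with y hy
      rw [hφ.diffFlux_eq hD hz.zero hy]
    have hgc : ContinuousOn (fun ξ => g (φ ξ)) (Iio b) :=
      hd.g_continuousOn.comp hφ.continuousOn fun ξ hξ => Ico_subset_Icc_self (hφ.mem_Ico ξ hξ)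
    have := setIntegral_mul_deriv_test isOpen_Iio hder hgc.neg h1 h2 h3
    have hWc : ContinuousOn (fun ξ => diffFlux D φ ξ - f (φ ξ) + c * φ ξ) (Iio b) :=
      fun ξ hξ => (hder ξ hξ).continuousAt.continuousWithinAt
    rw [integral_sub
      (integrableOn_mul_test (hWc.locallyIntegrableOn measurableSet_Iio)
        (h1.continuous_deriv (by simp)) h2.deriv
        ((tsupport_deriv_subset (𝕜 := ℝ) (f := ψ)).trans h3))
      (integrableOn_mul_test (hgc.locallyIntegrableOn measurableSet_Iio) h1.continuous h2 h3),
      this]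
    simp_rw [neg_mul]
    rw [integral_neg]
    ring

theorem isSemiWavefrontFrom (hr : 0 < r) (hd : IsData r f D g) (hD : DHat r D) (hg : GHat r g)
    (hz : IsFirstOrderSol r (rate r f c) (reaction D g) z) (hφ : IsProfile r D z b φ) :
    IsSemiWavefrontFrom r f D g c 0 b φ where
  isTravelingWave := hφ.isTravelingWave hr hd hD hg hz
  mem_Icc := ⟨le_rfl, hr.le⟩
  g_eq_zero := hg.2
  monotonic := Or.inl hφ.monotoneOn
  nonconstant := by
    rintro ⟨k, hk⟩
    obtain ⟨x, hx, h1⟩ := hφ.surjective (r / 2) ⟨by linarith, by linarith⟩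
    obtain ⟨y, hy, h2⟩ := hφ.surjective (r / 3) ⟨by linarith, by linarith⟩
    have := hk x hx
    have := hk y hy
    linarith
  tendsto := hφ.tendsto

/-- A profile is classical wherever it is differentiable. -/
theorem isClassicalOn (hr : 0 < r) (hd : IsData r f D g) (hD : DHat r D) (hg : GHat r g)
    (hz : IsFirstOrderSol r (rate r f c) (reaction D g) z) (hφ : IsProfile r D z b φ) {U : Set ℝ}
    (hUm : MeasurableSet U) (hU : U ⊆ Iio b) (hdiff : ∀ ξ ∈ U, DifferentiableAt ℝ φ ξ) :
    IsClassicalOn r f D g c U φ := by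
  have hder : ∀ ξ ∈ U, HasDerivAt (diffFlux D φ)
      (-g (φ ξ) + (dot r f (φ ξ) - c) * deriv φ ξ) ξ := by
    intro ξ hξ
    have hξb : ξ < b := hU hξ
    have hf : HasDerivAt (fun y => f (φ y)) (dot r f (φ ξ) * deriv φ ξ) ξ := by
      have h1 := (hd.hasDerivWithinAt (Ico_subset_Icc_self (hφ.mem_Ico ξ hξb))).comp ξ
        ((hdiff ξ hξ).hasDerivAt.hasDerivWithinAt (s := Iio b))
        fun y hy => Ico_subset_Icc_self (hφ.mem_Ico y hy)
      exact h1.hasDerivAt (Iio_mem_nhds hξb)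
    have h := ((hφ.hasDerivAt_flux hr hd hD hg hz hξb).add hf).sub
      ((hdiff ξ hξ).hasDerivAt.const_mul c)
    refine (h.congr_of_eventuallyEq ?_).congr_deriv (by ring)
    filter_upwards [Iio_mem_nhds hξb] with y hy
    rw [hφ.diffFlux_eq hD hz.zero hy]
    simp only [Pi.add_apply, Pi.sub_apply]
    ring
  refine ⟨hdiff, ?_, ?_⟩
  · intro x y hxy hsub
    have hsub' : Icc x y ⊆ Iio b := hsub.trans hU
    have hmaps : ∀ ξ ∈ uIcc x y, φ ξ ∈ Icc 0 r := fun ξ hξ => by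
      rw [uIcc_of_le hxy] at hξ
      exact Ico_subset_Icc_self (hφ.mem_Ico ξ (hsub' hξ))
    have hφc : ContinuousOn φ (uIcc x y) := by
      rw [uIcc_of_le hxy]
      exact hφ.continuousOn.mono hsub'
    -- Monotonicity of `φ` gives the integrability of `deriv φ`, with no continuity or bound of the
    -- derivative.
    have h1 : IntervalIntegrable (deriv φ) volume x y := by
      refine MonotoneOn.intervalIntegrable_deriv ?_
      rw [uIcc_of_le hxy]
      exact hφ.monotoneOn.mono hsub'
    have h2 : ContinuousOn (fun ξ => dot r f (φ ξ) - c) (uIcc x y) :=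
      ((hd.continuousOn_dot hr).comp hφc hmaps).sub continuousOn_const
    have h3 : ContinuousOn (fun ξ => -g (φ ξ)) (uIcc x y) :=
      (hd.g_continuousOn.comp hφc hmaps).neg
    have hint : IntervalIntegrable
        (fun ξ => -g (φ ξ) + (dot r f (φ ξ) - c) * deriv φ ξ) volume x y :=
      h3.intervalIntegrable.add (h1.continuousOn_mul h2)
    have hac := hint.absolutelyContinuousOnInterval_intervalIntegral (c := x) left_mem_uIcc
    have hconst : AbsolutelyContinuousOnInterval (fun _ : ℝ => diffFlux D φ x) x y :=
      (LipschitzWith.const (diffFlux D φ x)).lipschitzOnWith.absolutelyContinuousOnInterval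
    refine (hconst.add hac).congr_of_eqOn ?_
    rw [uIcc_of_le hxy]
    intro ξ hξ
    have hsub₂ : uIcc x ξ ⊆ Icc x y := by
      rw [uIcc_of_le hξ.1]
      exact Icc_subset_Icc_right hξ.2
    rw [Pi.add_apply, intervalIntegral.integral_eq_sub_of_hasDerivAt
      (fun t ht => hder t (hsub (hsub₂ ht))) (hint.mono_set (by rwa [uIcc_of_le hxy]))]
    exact (add_sub_cancel _ _).symm
  · rw [ae_restrict_iff' hUm]
    refine Eventually.of_forall fun ξ hξ => ?_
    rw [(hder ξ hξ).deriv]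
    ring

/-- A profile that is not differentiable at some point is sharp at zero. -/
theorem isSharpAt (hr : 0 < r) (hd : IsData r f D g) (hD : DHat r D) (hg : GHat r g)
    (hz : IsFirstOrderSol r (rate r f c) (reaction D g) z) (hφ : IsProfile r D z b φ) {A : ℝ}
    (hA : A < b) (hnd : ¬ DifferentiableAt ℝ φ A) : IsSharpAt r f D g c (Iio b) φ 0 := by
  have hA0 : φ A = 0 := by
    by_contra hne
    exact hnd (hφ.hasDerivAt A hA (lt_of_le_of_ne (hφ.mem_Ico A hA).1
      (Ne.symm hne))).differentiableAt
  refine ⟨hg.2, A, hA, hA0, ?_, hnd⟩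
  refine hφ.isClassicalOn hr hd hD hg hz (measurableSet_Iio.diff (measurableSet_singleton A))
    sdiff_subset ?_
  rintro ξ ⟨hξ, hne⟩
  obtain ⟨A', hA'⟩ := hφ.exists_differentiableAt_of_ne hr
  have hAA' : A = A' := by
    by_contra h
    exact hnd (hA' A hA h)
  exact hA' ξ hξ fun h => hne (h.trans hAA'.symm)

theorem isClassicalOrSharp (hr : 0 < r) (hd : IsData r f D g) (hD : DHat r D) (hg : GHat r g)
    (hz : IsFirstOrderSol r (rate r f c) (reaction D g) z) (hφ : IsProfile r D z b φ) :
    IsClassicalOrSharp r f D g c (Iio b) φ := by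
  by_cases h : ∀ ξ < b, DifferentiableAt ℝ φ ξ
  · exact Or.inl (hφ.isClassicalOn hr hd hD hg hz measurableSet_Iio Subset.rfl h)
  · push Not at h
    obtain ⟨A, hA, hnd⟩ := h
    exact Or.inr ⟨0, hφ.isSharpAt hr hd hD hg hz hA hnd⟩

/-- If `z / D` tends to zero at `0`, the profile is classical. -/
theorem isClassicalOn_of_tendsto (hr : 0 < r) (hd : IsData r f D g) (hD : DHat r D)
    (hg : GHat r g) (hz : IsFirstOrderSol r (rate r f c) (reaction D g) z)
    (hφ : IsProfile r D z b φ) (hlim : Tendsto (fun s => z s / D s) (𝓝[>] 0) (𝓝 0)) :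
    IsClassicalOn r f D g c (Iio b) φ := by
  refine hφ.isClassicalOn hr hd hD hg hz measurableSet_Iio Subset.rfl fun ξ hξ => ?_
  -- The quotient is `0` at `0` whatever `D 0` is, division by zero included, so the hypothesis on
  -- the limit says exactly that `z / D` is right-continuous at `0`.
  have h0 : z 0 / D 0 = 0 := by rw [hz.zero, zero_div]
  have hG : ContinuousOn (fun s => z s / D s) (Ico 0 r) := by
    intro s hs
    rcases hs.1.eq_or_lt with rfl | hpos
    · have : ContinuousWithinAt (fun s => z s / D s) (Ici 0) 0 :=
        continuousWithinAt_Ioi_iff_Ici.1 (by rwa [ContinuousWithinAt, h0])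
      exact this.mono Ico_subset_Ici_self
    · exact ((hz.continuousOn s hs).div ((hd.D_contDiffOn.continuousOn.mono Ico_subset_Icc_self) s
        hs) (hD s ⟨hpos, hs.2⟩).ne')
  exact (hφ.hasDerivAt_comp hr (F := fun s => s) (F' := fun _ => 1) continuousOn_id hG h0
    (fun s _ => hasDerivAt_id s) (fun s _ => one_mul _) hξ).differentiableAt

/-- If `D` is dominated by `z` near `0`, the profile is sharp. -/
theorem isSharpAt_of_le (hr : 0 < r) (hd : IsData r f D g) (hD : DHat r D)
    (hg : GHat r g) (hz : IsFirstOrderSol r (rate r f c) (reaction D g) z)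
    (hφ : IsProfile r D z b φ) {κ : ℝ} (hκ : 0 < κ) (hle : ∀ᶠ s in 𝓝[>] 0, κ * D s ≤ z s) :
    IsSharpAt r f D g c (Iio b) φ 0 := by
  obtain ⟨s₀, hs₀, hle'⟩ := (mem_nhdsGT_iff_exists_Ioo_subset).1 hle
  have hs₀ : 0 < s₀ := hs₀
  have hslope : ∀ ξ < b, 0 < φ ξ → φ ξ < s₀ → κ ≤ z (φ ξ) / D (φ ξ) := fun ξ hξ h1 h2 =>
    (le_div_iff₀ (hD _ ⟨h1, (hφ.mem_Ico ξ hξ).2⟩)).2 (hle' ⟨h1, h2⟩)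
  have hgrow : ∀ x y, x < y → y < b → (∀ ξ ∈ Ioo x y, 0 < φ ξ) → φ y < s₀ →
      κ * (y - x) ≤ φ y - φ x := by
    intro x y hxy hy hpos hys
    have hm : MonotoneOn (fun ξ => φ ξ - κ * ξ) (Icc x y) := by
      have hder : ∀ ξ ∈ Ioo x y, HasDerivAt (fun ξ => φ ξ - κ * ξ)
          (z (φ ξ) / D (φ ξ) - κ * 1) ξ := fun ξ hξ =>
        (hφ.hasDerivAt ξ (hξ.2.trans hy) (hpos ξ hξ)).sub ((hasDerivAt_id ξ).const_mul κ)
      refine monotoneOn_of_deriv_nonneg (convex_Icc x y) ?_ ?_ ?_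
      · exact (hφ.continuousOn.mono fun t ht => ht.2.trans_lt hy).sub (by fun_prop)
      · rw [interior_Icc]
        exact fun ξ hξ => (hder ξ hξ).differentiableAt.differentiableWithinAt
      · rw [interior_Icc]
        intro ξ hξ
        rw [(hder ξ hξ).deriv]
        have hξb := hξ.2.trans hy
        have := hslope ξ hξb (hpos ξ hξ) ((hφ.monotoneOn hξb hy hξ.2.le).trans_lt hys)
        linarith
    have := hm ⟨le_rfl, hxy.le⟩ ⟨hxy.le, le_rfl⟩ hxy.le
    simp only at this
    linarith
  rcases hφ.pos_or_exists hr with h | ⟨A, hA, h0, hpos⟩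
  -- A wave positive everywhere is impossible: going left from a small value `φ y` with slope at
  -- least `κ`, it would be exhausted within the length `φ y / κ`.
  · exfalso
    obtain ⟨y, hy1, hy2⟩ := ((hφ.tendsto.eventually (gt_mem_nhds hs₀)).and
      (Iio_mem_atBot b)).exists
    have hy2 : y < b := hy2
    have h1 : 0 < φ y / κ := div_pos (h y hy2) hκ
    have h2 := hgrow (y - φ y / κ) y (by linarith) hy2 (fun ξ hξ => h ξ (hξ.2.trans hy2)) hy1
    have h3 : κ * (y - (y - φ y / κ)) = φ y := by
      field_simp
      ring
    have h4 := h (y - φ y / κ) (by linarith)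
    linarith
  -- At the end `A` of the zero set a derivative would have to be `0` by the left side, while
  -- difference quotients on the right are at least `κ`.
  · refine hφ.isSharpAt hr hd hD hg hz hA fun hdiff => ?_
    have hd0 : HasDerivAt φ 0 A := by
      have := hdiff.hasDerivAt
      rwa [deriv_eq_zero_of_eq_zero_left h0] at this
    have hsl := hd0.tendsto_slope
    have hev : ∀ᶠ y in 𝓝[>] A, slope φ A y < κ :=
      (hsl.mono_left (nhdsWithin_mono _ fun y hy => ne_of_gt hy)).eventually (gt_mem_nhds hκ)
    have hsmall : ∀ᶠ y in 𝓝[>] A, φ y < s₀ := by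
      have := (hφ.continuousAt hA).continuousWithinAt (s := Ioi A)
      rw [ContinuousWithinAt, h0 A le_rfl] at this
      exact this.eventually (gt_mem_nhds hs₀)
    obtain ⟨y, ⟨hy1, hy2⟩, hy3⟩ := ((hev.and hsmall).and (Ioo_mem_nhdsGT hA)).exists
    have h1 := hgrow A y hy3.1 hy3.2 (fun ξ hξ => hpos ξ ⟨hξ.1, hξ.2.trans hy3.2⟩) hy2
    rw [slope_def_field, div_lt_iff₀ (by linarith [hy3.1])] at hy1
    linarith

end IsProfile

/-! ### The integrated equation -/

namespace IsTravelingWave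

variable {I : Set ℝ} {θ : ℝ → ℝ}

theorem continuousOn_comp (hθ : IsTravelingWave r f D g c I θ) {F : ℝ → ℝ}
    (hF : ContinuousOn F (Icc 0 r)) : ContinuousOn (fun ξ => F (θ ξ)) I :=
  hF.comp hθ.continuousOn hθ.mapsTo

/-- The diffusive flux of a traveling wave is almost everywhere equal to a continuous function,
obtained by integrating the equation once. -/
theorem ae_diffFlux_eq (hd : IsData r f D g) (hθ : IsTravelingWave r f D g c I θ) {x₀ : ℝ}
    (hx₀ : x₀ ∈ I) : ∃ K : ℝ, ∀ᵐ x ∂(volume.restrict I),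
      diffFlux D θ x = f (θ x) - c * θ x - (∫ t in x₀..x, g (θ t)) + K := by
  have hfc := hθ.continuousOn_comp hd.f_contDiffOn.continuousOn
  have hgc := hθ.continuousOn_comp hd.g_continuousOn
  have hI := hθ.isOpen
  have hcc : ContinuousOn (fun x => c * θ x) I := continuousOn_const.mul hθ.continuousOn
  have hu : LocallyIntegrableOn (fun x => diffFlux D θ x - f (θ x) + c * θ x) I volume :=
    (hθ.locallyIntegrableOn.sub (hfc.locallyIntegrableOn hI.measurableSet)).add
      (hcc.locallyIntegrableOn hI.measurableSet)
  -- The weak equation says that `-g(θ)` is the weak derivative of the total flux `D(θ) θ' - f(θ) +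
  -- c θ`.
  obtain ⟨K, hK⟩ := ae_eq_primitive_of_weakDeriv hI hθ.ordConnected hu hgc.neg (fun ψ h1 h2 h3 => by
    have := hθ.weakEquation ψ h1 h2 h3
    rw [integral_sub
      (integrableOn_mul_test hu (h1.continuous_deriv (by simp)) h2.deriv
        ((tsupport_deriv_subset (𝕜 := ℝ) (f := ψ)).trans h3))
      (integrableOn_mul_test (hgc.locallyIntegrableOn hI.measurableSet) h1.continuous h2 h3)] at this
    simp_rw [Pi.neg_apply, neg_mul]
    rw [integral_neg]
    linarith) hx₀
  refine ⟨K, ?_⟩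
  filter_upwards [hK] with x hx
  simp only [Pi.neg_apply, intervalIntegral.integral_neg] at hx
  linarith

theorem continuousOn_fluxRepr (hd : IsData r f D g) (hθ : IsTravelingWave r f D g c I θ) {x₀ : ℝ}
    (hx₀ : x₀ ∈ I) (K : ℝ) :
    ContinuousOn (fun x => f (θ x) - c * θ x - (∫ t in x₀..x, g (θ t)) + K) I := by
  have hfc := hθ.continuousOn_comp hd.f_contDiffOn.continuousOn
  have hgc := hθ.continuousOn_comp hd.g_continuousOn
  have hG : ContinuousOn (fun x => ∫ t in x₀..x, g (θ t)) I := fun x hx =>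
    (hasDerivAt_primitive hθ.isOpen hθ.ordConnected hgc hx₀
      hx).continuousAt.continuousWithinAt
  exact ((hfc.sub (continuousOn_const.mul hθ.continuousOn)).sub hG).add continuousOn_const

/-- The continuous representative of the diffusive flux and its derivative. -/
theorem exists_fluxRepr (hd : IsData r f D g) (hθ : IsTravelingWave r f D g c I θ)
    (hne : I.Nonempty) : ∃ w : ℝ → ℝ, ContinuousOn w I ∧
      (∀ᵐ ξ ∂(volume.restrict I), diffFlux D θ ξ = w ξ) ∧
      ∀ ξ ∈ I, DifferentiableAt ℝ θ ξ →
        HasDerivAt w ((dot r f (θ ξ) - c) * deriv θ ξ - g (θ ξ)) ξ := by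
  obtain ⟨x₀, hx₀⟩ := hne
  obtain ⟨K, hK⟩ := hθ.ae_diffFlux_eq hd hx₀
  refine ⟨_, hθ.continuousOn_fluxRepr hd hx₀ K, hK, fun ξ hξ hdiff => ?_⟩
  have hf : HasDerivAt (fun y => f (θ y)) (dot r f (θ ξ) * deriv θ ξ) ξ := by
    have h1 := (hd.hasDerivWithinAt (hθ.mapsTo hξ)).comp ξ
      (hdiff.hasDerivAt.hasDerivWithinAt (s := I)) hθ.mapsTo
    exact h1.hasDerivAt (hθ.isOpen.mem_nhds hξ)
  have hG := hasDerivAt_primitive hθ.isOpen hθ.ordConnected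
    (hθ.continuousOn_comp hd.g_continuousOn) hx₀ hξ
  exact (((hf.sub (hdiff.hasDerivAt.const_mul c)).sub hG).add_const K).congr_deriv (by ring)

end IsTravelingWave

/-! ### Strictness -/

/-- A profile that reaches the value `r` at `b` cannot be continued beyond `b`. -/
theorem IsProfile.isStrict {z : ℝ → ℝ} {b : ℝ} {φ : ℝ → ℝ} (hr : 0 < r) (hd : IsData r f D g)
    (hD : DHat r D) (hg : GHat r g) (hz : IsFirstOrderSol r (rate r f c) (reaction D g) z)
    (hφ : IsProfile r D z b φ) : IsStrict r f D g c (Iio b) φ := by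
  refine ⟨fun h => absurd (h.ge (mem_univ b)) (lt_irrefl b), ?_⟩
  rintro ⟨Φ, hΦ, heq⟩
  have hΦc : Continuous Φ := continuousOn_univ.1 hΦ.continuousOn
  have hmem : ∀ ξ, Φ ξ ∈ Icc 0 r := fun ξ => hΦ.mapsTo (mem_univ ξ)
  -- The monotone `φ` takes every value below `r` to the left of `b`, and `Φ` is continuous at `b`.
  have hΦb : Φ b = r := by
    refine le_antisymm (hmem b).2 (le_of_forall_lt_imp_le_of_dense fun s hs => ?_)
    rcases le_or_gt s 0 with h | h
    · exact h.trans (hmem b).1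
    · obtain ⟨ξ, hξ, hs'⟩ := hφ.surjective s ⟨h, hs⟩
      refine ge_of_tendsto (hΦc.continuousAt.continuousWithinAt (s := Iio b)) ?_
      filter_upwards [Ioo_mem_nhdsLT hξ] with y hy
      rw [heq hy.2, ← hs']
      exact hφ.monotoneOn hξ hy.2 hy.1.le
  obtain ⟨K, hK⟩ := hΦ.ae_diffFlux_eq hd (mem_univ b)
  set w : ℝ → ℝ := fun x => f (Φ x) - c * Φ x - (∫ t in b..x, g (Φ t)) + K with hw
  have hwc : ContinuousOn w univ := hΦ.continuousOn_fluxRepr hd (mem_univ b) K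
  have hPc : Continuous fun ξ => ∫ s in (0 : ℝ)..Φ ξ, D s :=
    continuousOn_univ.1 (hΦ.continuousOn_comp (hd.continuousOn_primitive_D hr))
  obtain ⟨K', hK'⟩ := ae_eq_primitive_of_weakDeriv (u := fun ξ => ∫ s in (0 : ℝ)..Φ ξ, D s)
    (v := w) isOpen_univ ordConnected_univ
    (hPc.continuousOn.locallyIntegrableOn MeasurableSet.univ) hwc (fun ψ h1 h2 h3 => by
      rw [hΦ.weakDeriv ψ h1 h2 h3]
      congr 1
      refine integral_congr_ae ?_
      filter_upwards [hK] with x hx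
      rw [hx]) (mem_univ b)
  have hWd : ∀ x, HasDerivAt (fun x => K' + ∫ t in b..x, w t) (w x) x := fun x =>
    (hasDerivAt_primitive isOpen_univ ordConnected_univ hwc (mem_univ b) (mem_univ x)).const_add K'
  -- Two continuous functions equal almost everywhere coincide. So the primitive of `D` along `Φ` is
  -- continuously differentiable on the whole line with derivative `w`, although nothing is known of
  -- `Φ` beyond `b`.
  have hPeq : (fun ξ => ∫ s in (0 : ℝ)..Φ ξ, D s) = fun x => K' + ∫ t in b..x, w t := by
    rw [Measure.restrict_univ] at hK'
    exact Continuous.ae_eq_iff_eq volume hPc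
      (continuous_iff_continuousAt.2 fun x => (hWd x).continuousAt) |>.1 hK'
  have hPd : ∀ x, HasDerivAt (fun ξ => ∫ s in (0 : ℝ)..Φ ξ, D s) (w x) x := by
    rw [hPeq]
    exact hWd
  have hwb : w b = 0 := by
    refine IsLocalMax.hasDerivAt_eq_zero (Eventually.of_forall fun x => ?_) (hPd b)
    simp only [hΦb]
    exact hd.primitive_D_le hr hD (hmem x)
  have hK0 : K = -(f r - c * r) := by
    simp only [hw, hΦb, intervalIntegral.integral_same] at hwb
    linarith
  have hgc : Continuous fun t => g (Φ t) :=
    continuousOn_univ.1 (hΦ.continuousOn_comp hd.g_continuousOn)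
  -- Each value `s < r` occurs at some `ξ < b`, where the flux `z s` is positive. Removing the
  -- contribution of `g` between `ξ` and `b`, which has a favourable sign, leaves an inequality in
  -- `s` alone. It can therefore be used also to the right of `b`.
  have hFpos : ∀ s ∈ Ioc 0 r, 0 ≤ f s - c * s + K := by
    intro s hs
    rcases hs.2.eq_or_lt with rfl | hsr
    · linarith
    · obtain ⟨ξ, hξ, rfl⟩ := hφ.surjective s ⟨hs.1, hsr⟩
      have h1 : w ξ = z (φ ξ) := by
        refine (hPd ξ).unique ((hφ.hasDerivAt_primitive_D hr hd hD hz hξ).congr_of_eventuallyEq ?_)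
        filter_upwards [Iio_mem_nhds hξ] with y hy
        rw [heq hy]
      have h2 : 0 < z (φ ξ) := hz.pos _ ⟨hs.1, hsr⟩
      have h3 : 0 ≤ ∫ t in b..ξ, g (Φ t) := by
        rw [intervalIntegral.integral_symm, neg_nonneg]
        have := intervalIntegral.integral_nonneg (f := fun t => -g (Φ t)) (μ := volume)
          (le_of_lt hξ) fun t _ => neg_nonneg.2 (hg.nonpos _ (hmem t))
        rw [intervalIntegral.integral_neg] at this
        linarith
      have h4 : Φ ξ = φ ξ := heq hξ
      simp only [hw, h4] at h1
      linarith
  have hev : ∀ᶠ ξ in 𝓝 b, 0 < Φ ξ := by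
    refine hΦc.continuousAt.eventually (lt_mem_nhds ?_)
    rwa [hΦb]
  obtain ⟨e, he, hball⟩ := Metric.eventually_nhds_iff.1 hev
  have hpos : ∀ ξ ∈ Icc b (b + e / 2), 0 < Φ ξ := fun ξ hξ => hball (by
    rw [Real.dist_eq, abs_of_nonneg (by linarith [hξ.1])]
    linarith [hξ.2])
  -- To the right of `b` the term `-∫ g(Φ)` is positive, so by `hFpos` the flux is positive as long
  -- as `Φ > 0`.
  have hmono : StrictMonoOn (fun ξ => ∫ s in (0 : ℝ)..Φ ξ, D s) (Icc b (b + e / 2)) := by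
    refine strictMonoOn_of_deriv_pos (convex_Icc _ _) hPc.continuousOn fun ξ hξ => ?_
    rw [interior_Icc] at hξ
    rw [(hPd ξ).deriv]
    have h1 := hFpos (Φ ξ) ⟨hpos ξ (Ioo_subset_Icc_self hξ), (hmem ξ).2⟩
    have h2 := intervalIntegral.intervalIntegral_pos_of_pos_on (f := fun t => -g (Φ t))
      (hgc.neg.intervalIntegrable b ξ) (fun t ht => neg_pos.2 (hg.1 _
        ⟨hpos t ⟨ht.1.le, (ht.2.trans hξ.2).le⟩, (hmem t).2⟩)) hξ.1
    rw [intervalIntegral.integral_neg] at h2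
    simp only [hw]
    linarith
  have h1 := hmono ⟨le_rfl, by linarith⟩ ⟨by linarith, le_rfl⟩ (show b < b + e / 2 by linarith)
  simp only [hΦb] at h1
  exact absurd (hd.primitive_D_le hr hD (hmem (b + e / 2))) (not_le.2 h1)

/-! ### Uniqueness -/

theorem IsClassicalOn.continuousAt_diffFlux {U : Set ℝ} {θ : ℝ → ℝ}
    (h : IsClassicalOn r f D g c U θ) (hU : IsOpen U) {ξ : ℝ} (hξ : ξ ∈ U) :
    ContinuousAt (diffFlux D θ) ξ := by
  obtain ⟨e, he, hball⟩ := Metric.isOpen_iff.1 hU ξ hξ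
  have hsub : Icc (ξ - e / 2) (ξ + e / 2) ⊆ U := fun x hx => hball (by
    rw [Metric.mem_ball, Real.dist_eq, abs_lt]
    constructor <;> linarith [hx.1, hx.2])
  have hc := (h.absolutelyContinuous _ _ (by linarith) hsub).continuousOn
  rw [uIcc_of_le (by linarith)] at hc
  exact hc.continuousAt (Icc_mem_nhds (by linarith) (by linarith))

/-- A sharp point must lie at a zero of `g`, and `0` is the only one; points where the wave is
positive are thus classical. -/
theorem IsClassicalOrSharp.regular_of_pos {b : ℝ} {θ : ℝ → ℝ} (hg : GHat r g)
    (hmaps : MapsTo θ (Iio b) (Icc 0 r)) (h : IsClassicalOrSharp r f D g c (Iio b) θ) {ξ : ℝ}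
    (hξ : ξ < b) (hpos : 0 < θ ξ) :
    DifferentiableAt ℝ θ ξ ∧ ContinuousAt (diffFlux D θ) ξ := by
  rcases h with h | ⟨l, hl, ξ₀, hξ₀, hθξ₀, h, -⟩
  · exact ⟨h.differentiableAt ξ hξ, h.continuousAt_diffFlux isOpen_Iio hξ⟩
  · have hl0 : l = 0 := by
      by_contra hne
      have hmem := hmaps hξ₀
      rw [hθξ₀] at hmem
      exact (hg.1 l ⟨lt_of_le_of_ne hmem.1 (Ne.symm hne), hmem.2⟩).ne hl
    have hU : ξ ∈ Iio b \ {ξ₀} := by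
      refine ⟨hξ, fun h => ?_⟩
      rw [mem_singleton_iff.1 h, hθξ₀, hl0] at hpos
      exact lt_irrefl _ hpos
    exact ⟨h.differentiableAt ξ hU,
      h.continuousAt_diffFlux (isOpen_Iio.sdiff isClosed_singleton) hU⟩

namespace IsSemiWavefrontFrom

variable {b : ℝ} {θ : ℝ → ℝ}

theorem nonneg (hθ : IsSemiWavefrontFrom r f D g c 0 b θ) {ξ : ℝ} (hξ : ξ < b) : 0 ≤ θ ξ :=
  (hθ.isTravelingWave.mapsTo hξ).1

/-- A nonincreasing wave with limit `0` at `-∞` is at most `0`, hence constant. -/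
theorem monotoneOn (hθ : IsSemiWavefrontFrom r f D g c 0 b θ) : MonotoneOn θ (Iio b) := by
  rcases hθ.monotonic with h | h
  · exact h
  · refine absurd ⟨0, fun ξ hξ => le_antisymm ?_ (hθ.nonneg hξ)⟩ hθ.nonconstant
    refine ge_of_tendsto hθ.tendsto ?_
    filter_upwards [Iic_mem_atBot ξ] with y hy
    exact h (mem_Iio.2 ((mem_Iic.1 hy).trans_lt hξ)) hξ hy

theorem exists_pos (hθ : IsSemiWavefrontFrom r f D g c 0 b θ) : ∃ ξ < b, 0 < θ ξ := by
  by_contra! h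
  exact hθ.nonconstant ⟨0, fun ξ hξ => le_antisymm (h ξ hξ) (hθ.nonneg hξ)⟩

theorem deriv_nonneg (hθ : IsSemiWavefrontFrom r f D g c 0 b θ) {ξ : ℝ} (hξ : ξ < b) :
    0 ≤ deriv θ ξ := by
  rw [← derivWithin_of_mem_nhds (Iio_mem_nhds hξ)]
  exact hθ.monotoneOn.derivWithin_nonneg

/-- Where a semi-wavefront from zero is positive, it is differentiable and its flux has a
continuous representative with the derivative given by the equation. -/
theorem exists_fluxRepr (hd : IsData r f D g) (hg : GHat r g)
    (hθ : IsSemiWavefrontFrom r f D g c 0 b θ)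
    (hcs : IsClassicalOrSharp r f D g c (Iio b) θ) :
    ∃ w : ℝ → ℝ, ContinuousOn w (Iio b) ∧
      (∀ᵐ ξ ∂(volume.restrict (Iio b)), diffFlux D θ ξ = w ξ) ∧
      ∀ ξ < b, 0 < θ ξ → DifferentiableAt ℝ θ ξ ∧ diffFlux D θ ξ = w ξ ∧
        HasDerivAt w ((dot r f (θ ξ) - c) * deriv θ ξ - g (θ ξ)) ξ := by
  have htw := hθ.isTravelingWave
  obtain ⟨w, h1, h2, h3⟩ := htw.exists_fluxRepr hd ⟨b - 1, by simp⟩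
  refine ⟨w, h1, h2, fun ξ hξ hpos => ?_⟩
  have hreg := fun {y : ℝ} (hy : y < b) (h : 0 < θ y) => hcs.regular_of_pos hg htw.mapsTo hy h
  refine ⟨(hreg hξ hpos).1, ?_, h3 ξ hξ (hreg hξ hpos).1⟩
  have hopen : IsOpen (Iio b ∩ θ ⁻¹' Ioi 0) :=
    htw.continuousOn.isOpen_inter_preimage isOpen_Iio isOpen_Ioi
  -- The flux is continuous where `θ > 0`, so its almost everywhere equality with `w` is an equality
  -- at each such point.
  have := Measure.eqOn_open_of_ae_eq (μ := volume) (f := diffFlux D θ) (g := w)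
    (U := Iio b ∩ θ ⁻¹' Ioi 0) (ae_restrict_of_ae_restrict_of_subset inter_subset_left h2) hopen
    (fun y hy => (hreg hy.1 hy.2).2.continuousWithinAt) (h1.mono inter_subset_left)
  exact this ⟨hξ, hpos⟩

/-- By monotonicity a wave that reaches `r` stays there; its flux and its slope then vanish on an
interval, and the equation would give `g r = 0`. -/
theorem lt_of_lt (hr : 0 < r) (hd : IsData r f D g) (hg : GHat r g)
    (hθ : IsSemiWavefrontFrom r f D g c 0 b θ)
    (hcs : IsClassicalOrSharp r f D g c (Iio b) θ) {ξ : ℝ} (hξ : ξ < b) : θ ξ < r := by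
  have hmem := fun {y : ℝ} (hy : y < b) => hθ.isTravelingWave.mapsTo (show y ∈ Iio b from hy)
  refine lt_of_le_of_ne (hmem hξ).2 fun heq => ?_
  obtain ⟨w, h1, h2, h3⟩ := hθ.exists_fluxRepr hd hg hcs
  have hconst : ∀ y ∈ Ioo ξ b, θ y = r := fun y hy =>
    le_antisymm (hmem hy.2).2 (heq.symm.trans_le (hθ.monotoneOn hξ hy.2 hy.1.le))
  have hder : ∀ y ∈ Ioo ξ b, deriv θ y = 0 := by
    intro y hy
    have : θ =ᶠ[𝓝 y] fun _ => r := by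
      filter_upwards [Ioo_mem_nhds hy.1 hy.2] with t ht using hconst t ht
    rw [this.deriv_eq, deriv_const]
  have hw : ∀ y ∈ Ioo ξ b, w y = 0 := by
    intro y hy
    rw [← (h3 y hy.2 (by rwa [hconst y hy])).2.1, diffFlux, hder y hy, mul_zero]
  obtain ⟨y, hy⟩ := exists_between hξ
  have hd1 := (h3 y hy.2 (by rwa [hconst y hy])).2.2
  have hd2 : HasDerivAt w 0 y := by
    refine (hasDerivAt_const y (0 : ℝ)).congr_of_eventuallyEq ?_
    filter_upwards [Ioo_mem_nhds hy.1 hy.2] with t ht using hw t ht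
  have := hd1.unique hd2
  rw [hder y hy, hconst y hy] at this
  have := hg.1 r ⟨hr, le_rfl⟩
  linarith

/-- The flux of a semi-wavefront from zero becomes small towards the left end of the set where the
profile is positive. -/
theorem exists_flux_lt (hr : 0 < r) (hd : IsData r f D g) (hg : GHat r g)
    (hθ : IsSemiWavefrontFrom r f D g c 0 b θ)
    (hcs : IsClassicalOrSharp r f D g c (Iio b) θ) {z : ℝ → ℝ} (hz0 : z 0 = 0)
    (hzc : ContinuousOn z (Ico 0 r)) {ξ₁ ε : ℝ} (hξ₁ : ξ₁ < b) (hpos₁ : 0 < θ ξ₁) (hε : 0 < ε) :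
    ∃ ξ < ξ₁, 0 < θ ξ ∧ diffFlux D θ ξ < ε ∧ z (θ ξ) < ε := by
  obtain ⟨w, h1, h2, h3⟩ := hθ.exists_fluxRepr hd hg hcs
  have hmem : ∀ ξ < b, θ ξ ∈ Ico 0 r := fun ξ hξ =>
    ⟨hθ.nonneg hξ, hθ.lt_of_lt hr hd hg hcs hξ⟩
  have hzθ : ContinuousOn (fun ξ => z (θ ξ)) (Iio b) :=
    hzc.comp hθ.isTravelingWave.continuousOn hmem
  rcases pos_or_exists_zero_set (fun ξ hξ => hθ.nonneg hξ) hθ.isTravelingWave.continuousOn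
    hθ.monotoneOn hθ.exists_pos with hall | ⟨A, hA, hzero, hpos⟩
  · have hθlim : Tendsto θ atBot (𝓝[Ico 0 r] 0) := by
      refine tendsto_nhdsWithin_iff.2 ⟨hθ.tendsto, ?_⟩
      filter_upwards [Iio_mem_atBot b] with y hy using hmem y hy
    have hzlim : Tendsto (fun ξ => z (θ ξ)) atBot (𝓝 0) := by
      have := (hzc 0 ⟨le_rfl, hr⟩).tendsto.comp hθlim
      rwa [hz0] at this
    obtain ⟨ξ₂, hξ₂⟩ := eventually_atBot.1
      ((hzlim.eventually (gt_mem_nhds hε)).and (Iio_mem_atBot ξ₁))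
    by_contra! hcon
    have hflux : ∀ ξ ≤ ξ₂, ε ≤ diffFlux D θ ξ := by
      intro ξ hξ
      by_contra! hlt
      exact absurd (hξ₂ ξ hξ).1
        (not_lt.2 (hcon ξ (hξ₂ ξ hξ).2 (hall ξ ((hξ₂ ξ hξ).2.trans hξ₁)) hlt))
    have hξ₂b : ξ₂ < b := (hξ₂ ξ₂ le_rfl).2.trans hξ₁
    obtain ⟨M, hM⟩ := isCompact_Icc.exists_bound_of_continuousOn hd.D_contDiffOn.continuousOn
    have hM0 : 0 ≤ M := (norm_nonneg _).trans (hM 0 ⟨le_rfl, hr.le⟩)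
    -- A flux of at least `ε` on a left half line keeps the slope away from zero, and `θ` would
    -- become negative. The divisor `M + 1` is positive even if `M = 0`.
    have hslope : ∀ ξ ≤ ξ₂, ε / (M + 1) ≤ deriv θ ξ := by
      intro ξ hξ
      have hξb : ξ < b := hξ.trans_lt hξ₂b
      have h4 := hflux ξ hξ
      have h5 := hM (θ ξ) (Ico_subset_Icc_self (hmem ξ hξb))
      rw [Real.norm_eq_abs] at h5
      have h6 : D (θ ξ) * deriv θ ξ ≤ (M + 1) * deriv θ ξ :=
        mul_le_mul_of_nonneg_right (by linarith [le_abs_self (D (θ ξ))]) (hθ.deriv_nonneg hξb)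
      rw [div_le_iff₀ (by positivity)]
      rw [diffFlux] at h4
      linarith
    have hκ : 0 < ε / (M + 1) := by positivity
    set κ := ε / (M + 1)
    set x := ξ₂ - (θ ξ₂ + 1) / κ with hx
    have hθ2 : 0 < θ ξ₂ := hall ξ₂ hξ₂b
    have hxlt : x < ξ₂ := by
      have : 0 < (θ ξ₂ + 1) / κ := by positivity
      linarith
    have hmono := (convex_Icc x ξ₂).mul_sub_le_image_sub_of_le_deriv
      (hθ.isTravelingWave.continuousOn.mono fun t ht => ht.2.trans_lt hξ₂b)
      (fun t ht => ((h3 t ((interior_subset ht).2.trans_lt hξ₂b)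
        (hall t ((interior_subset ht).2.trans_lt hξ₂b))).1).differentiableWithinAt)
      (fun t ht => hslope t (interior_subset ht).2) x ⟨le_rfl, hxlt.le⟩ ξ₂ ⟨hxlt.le, le_rfl⟩ hxlt.le
    have h7 : κ * (ξ₂ - x) = θ ξ₂ + 1 := by
      rw [hx]
      field_simp
      ring
    linarith [hθ.nonneg (hxlt.trans hξ₂b)]
  -- The continuous representative vanishes left of `A`, where `θ` is constant, hence also at `A`:
  -- the flux cannot jump, even where the wave has a corner.
  · have hwA : w A = 0 := by
      have hEq : EqOn w (fun _ => 0) (Iio A) := by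
        refine Measure.eqOn_open_of_ae_eq (μ := volume) ?_ isOpen_Iio
          (h1.mono (Iio_subset_Iio hA.le)) continuousOn_const
        have h4 := ae_restrict_of_ae_restrict_of_subset (Iio_subset_Iio hA.le) h2
        have h5 : ∀ᵐ y ∂(volume.restrict (Iio A)), y ∈ Iio A := ae_restrict_mem measurableSet_Iio
        filter_upwards [h4, h5] with y hy hyA
        rw [← hy, diffFlux, deriv_eq_zero_of_eq_zero_left
          fun t ht => hzero t (ht.trans (le_of_lt hyA)), mul_zero]
      have hc : Tendsto w (𝓝[<] A) (𝓝 (w A)) :=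
        (h1.continuousAt (Iio_mem_nhds hA)).continuousWithinAt
      refine tendsto_nhds_unique hc (tendsto_const_nhds.congr' ?_)
      filter_upwards [self_mem_nhdsWithin] with y hy using (hEq hy).symm
    have hAξ : A < ξ₁ := by
      by_contra! h
      exact hpos₁.ne' (hzero ξ₁ h)
    have e1 : ∀ᶠ y in 𝓝[>] A, w y < ε := by
      have hc : Tendsto w (𝓝[>] A) (𝓝 (w A)) :=
        (h1.continuousAt (Iio_mem_nhds hA)).continuousWithinAt
      exact hc.eventually (gt_mem_nhds (by rwa [hwA]))
    have e2 : ∀ᶠ y in 𝓝[>] A, z (θ y) < ε := by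
      have hc : Tendsto (fun ξ => z (θ ξ)) (𝓝[>] A) (𝓝 (z (θ A))) :=
        (hzθ.continuousAt (Iio_mem_nhds hA)).continuousWithinAt
      exact hc.eventually (gt_mem_nhds (by rwa [hzero A le_rfl, hz0]))
    obtain ⟨ξ, ⟨h4, h5⟩, h6⟩ := ((e1.and e2).and (Ioo_mem_nhdsGT hAξ)).exists
    have hξb : ξ < b := h6.2.trans hξ₁
    have hξpos := hpos ξ ⟨h6.1, hξb⟩
    refine ⟨ξ, h6.2, hξpos, ?_, h5⟩
    rwa [(h3 ξ hξb hξpos).2.1]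

/-- The flux of a semi-wavefront from zero is the solution of the first order problem. -/
theorem diffFlux_eq (hr : 0 < r) (hd : IsData r f D g) (hD : DHat r D) (hg : GHat r g)
    {z : ℝ → ℝ} (hz : IsFirstOrderSol r (rate r f c) (reaction D g) z)
    (hθ : IsSemiWavefrontFrom r f D g c 0 b θ)
    (hcs : IsClassicalOrSharp r f D g c (Iio b) θ) {ξ₁ : ℝ} (hξ₁ : ξ₁ < b) (hpos₁ : 0 < θ ξ₁) :
    diffFlux D θ ξ₁ = z (θ ξ₁) := by
  obtain ⟨w, h1, h2, h3⟩ := hθ.exists_fluxRepr hd hg hcs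
  have hmem : ∀ ξ < b, 0 < θ ξ → θ ξ ∈ Ioo 0 r := fun ξ hξ h =>
    ⟨h, hθ.lt_of_lt hr hd hg hcs hξ⟩
  -- The difference of the two fluxes solves a linear equation whose coefficient `g(θ) / z(θ)` is
  -- negative, so neither sign of the difference can grow to the right.
  have hder : ∀ ξ < b, 0 < θ ξ → HasDerivAt (fun ξ => w ξ - z (θ ξ))
      (g (θ ξ) * (w ξ - z (θ ξ)) / z (θ ξ)) ξ := by
    intro ξ hξ hpos
    obtain ⟨h4, h5, h6⟩ := h3 ξ hξ hpos
    have hs := hmem ξ hξ hpos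
    refine (h6.sub ((hz.hasDerivAt _ hs).comp ξ h4.hasDerivAt)).congr_deriv ?_
    have hz' := (hz.pos _ hs).ne'
    rw [← h5, diffFlux]
    simp only [rate, reaction]
    field_simp
    ring
  have hposle : ∀ ξ < ξ₁, 0 < θ ξ → ∀ y ∈ Icc ξ ξ₁, y < b ∧ 0 < θ y := by
    intro ξ hξ hpos y hy
    have hyb : y < b := hy.2.trans_lt hξ₁
    exact ⟨hyb, hpos.trans_le (hθ.monotoneOn (hξ.trans hξ₁) hyb hy.1)⟩
  have hcontu : ∀ ξ < ξ₁, 0 < θ ξ → ContinuousOn (fun ξ => w ξ - z (θ ξ)) (Icc ξ ξ₁) :=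
    fun ξ hξ hpos y hy => (hder y (hposle ξ hξ hpos y hy).1
      (hposle ξ hξ hpos y hy).2).continuousAt.continuousWithinAt
  rw [(h3 ξ₁ hξ₁ hpos₁).2.1]
  refine le_antisymm (le_of_forall_pos_le_add fun ε hε => ?_)
    (le_of_forall_pos_le_add fun ε hε => ?_)
  all_goals
    obtain ⟨ξ, hξ, hpos, hlt, hzlt⟩ := hθ.exists_flux_lt hr hd hg hcs hz.zero hz.continuousOn
      hξ₁ hpos₁ hε
    have hξb := hξ.trans hξ₁
    rw [(h3 ξ hξb hpos).2.1] at hlt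
    have hzpos := hz.pos _ (hmem ξ hξb hpos)
  · have := nonpos_of_deriv_nonpos_of_pos (u := fun y => w y - z (θ y) - ε) (a := ξ) (b := ξ₁)
      ((hcontu ξ hξ hpos).sub continuousOn_const) (by linarith) (fun y hy hy0 => ?_) ξ₁
      ⟨hξ.le, le_rfl⟩
    · linarith
    · obtain ⟨hyb, hypos⟩ := hposle ξ hξ hpos y (Ioo_subset_Icc_self hy)
      refine ⟨_, ?_, (hder y hyb hypos).sub_const ε⟩
      have hs := hmem y hyb hypos
      exact div_nonpos_of_nonpos_of_nonneg (mul_nonpos_of_nonpos_of_nonneg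
        (hg.nonpos _ (Ioo_subset_Icc_self hs)) (by linarith)) (hz.pos _ hs).le
  -- For the reverse bound the initial difference satisfies `z(θ) - w ≤ z(θ) < ε` because the flux
  -- of a nondecreasing wave is nonnegative.
  · have hw0 : 0 ≤ w ξ := by
      rw [← (h3 ξ hξb hpos).2.1, diffFlux]
      exact mul_nonneg (hD _ (hmem ξ hξb hpos)).le (hθ.deriv_nonneg hξb)
    have := nonpos_of_deriv_nonpos_of_pos (u := fun y => -(w y - z (θ y)) - ε) (a := ξ) (b := ξ₁)
      ((hcontu ξ hξ hpos).neg.sub continuousOn_const) (by linarith) (fun y hy hy0 => ?_) ξ₁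
      ⟨hξ.le, le_rfl⟩
    · linarith
    · obtain ⟨hyb, hypos⟩ := hposle ξ hξ hpos y (Ioo_subset_Icc_self hy)
      refine ⟨_, ?_, (hder y hyb hypos).neg.sub_const ε⟩
      have hs := hmem y hyb hypos
      rw [neg_nonpos]
      exact div_nonneg (mul_nonneg_of_nonpos_of_nonpos
        (hg.nonpos _ (Ioo_subset_Icc_self hs)) (by linarith)) (hz.pos _ hs).le

/-- Semi-wavefronts from zero are shifts of the profile. -/
theorem exists_shift (hr : 0 < r) (hd : IsData r f D g) (hD : DHat r D) (hg : GHat r g)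
    {z : ℝ → ℝ} (hz : IsFirstOrderSol r (rate r f c) (reaction D g) z) {b₀ : ℝ} {φ T : ℝ → ℝ}
    (hφ : IsProfile r D z b₀ φ)
    (hT : ∀ s ∈ Ioo 0 r, HasDerivAt T (D s / z s) s ∧ T s < b₀ ∧ φ (T s) = s)
    (hθ : IsSemiWavefrontFrom r f D g c 0 b θ)
    (hcs : IsClassicalOrSharp r f D g c (Iio b) θ) :
    ∃ τ : ℝ, b + τ ≤ b₀ ∧ ∀ ξ < b, θ ξ = φ (ξ + τ) := by
  have hmem : ∀ ξ < b, 0 < θ ξ → θ ξ ∈ Ioo 0 r := fun ξ hξ h =>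
    ⟨h, hθ.lt_of_lt hr hd hg hcs hξ⟩
  -- By the identity of the fluxes, `T' (θ) θ' = D(θ) θ' / z(θ) = 1`; hence `T(θ)` is the position
  -- up to a constant, the shift.
  have hder : ∀ ξ < b, 0 < θ ξ → HasDerivAt (fun ξ => T (θ ξ)) 1 ξ := by
    intro ξ hξ hpos
    have hs := hmem ξ hξ hpos
    have h1 := hθ.diffFlux_eq hr hd hD hg hz hcs hξ hpos
    have h2 := (hcs.regular_of_pos hg hθ.isTravelingWave.mapsTo hξ hpos).1
    refine ((hT _ hs).1.comp ξ h2.hasDerivAt).congr_deriv ?_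
    rw [diffFlux] at h1
    rw [div_mul_eq_mul_div, h1, div_self (hz.pos _ hs).ne']
  obtain ⟨ξ₁, hξ₁, hpos₁⟩ := hθ.exists_pos
  have hshift : ∀ x y, x ≤ y → y < b → 0 < θ x → T (θ y) - y = T (θ x) - x := by
    intro x y hxy hy hx
    have hp : ∀ t ∈ Icc x y, t < b ∧ 0 < θ t := fun t ht =>
      ⟨ht.2.trans_lt hy, hx.trans_le (hθ.monotoneOn (hxy.trans_lt hy) (ht.2.trans_lt hy) ht.1)⟩
    have hd' : ∀ t ∈ Icc x y, HasDerivAt (fun ξ => T (θ ξ) - ξ) (1 - 1) t := fun t ht =>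
      (hder t (hp t ht).1 (hp t ht).2).sub (hasDerivAt_id t)
    exact constant_of_has_deriv_right_zero
      (fun t ht => (hd' t ht).continuousAt.continuousWithinAt)
      (fun t ht => by simpa using (hd' t (Ico_subset_Icc_self ht)).hasDerivWithinAt) y
      ⟨hxy, le_rfl⟩
  have hτ : ∀ ξ < b, 0 < θ ξ → T (θ ξ) = ξ + (T (θ ξ₁) - ξ₁) := by
    intro ξ hξ hpos
    rcases le_total ξ ξ₁ with h | h
    · linarith [hshift ξ ξ₁ h hξ₁ hpos]
    · linarith [hshift ξ₁ ξ h hξ hpos₁]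
  set τ := T (θ ξ₁) - ξ₁
  have heq : ∀ ξ < b, 0 < θ ξ → θ ξ = φ (ξ + τ) := by
    intro ξ hξ hpos
    rw [← hτ ξ hξ hpos, (hT _ (hmem ξ hξ hpos)).2.2]
  have hlt : ∀ ξ < b, 0 < θ ξ → ξ + τ < b₀ := by
    intro ξ hξ hpos
    rw [← hτ ξ hξ hpos]
    exact (hT _ (hmem ξ hξ hpos)).2.1
  refine ⟨τ, ?_, ?_⟩
  · by_contra! hcon
    obtain ⟨ξ, h1, h2⟩ := exists_between (max_lt hξ₁ (show b₀ - τ < b by linarith))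
    have h3 := hlt ξ h2
      (hpos₁.trans_le (hθ.monotoneOn hξ₁ h2 ((le_max_left _ _).trans h1.le)))
    linarith [(le_max_right ξ₁ (b₀ - τ)).trans_lt h1]
  · intro ξ hξ
    rcases pos_or_exists_zero_set (fun ξ hξ => hθ.nonneg hξ) hθ.isTravelingWave.continuousOn
      hθ.monotoneOn hθ.exists_pos with hall | ⟨A, hA, hzero, hpos⟩
    · exact heq ξ hξ (hall ξ hξ)
    · rcases le_or_gt ξ A with h | h
      · obtain ⟨y₀, hy₀⟩ := exists_between hA
        have hAb : A + τ < b₀ := by linarith [hlt y₀ hy₀.2 (hpos y₀ hy₀), hy₀.1]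
        -- On the zero set of `θ` the inverse `T` gives no information; instead `φ (A + τ)` is
        -- bounded by the values of `θ` to the right of `A`, which tend to `0`.
        have hφA : φ (A + τ) ≤ 0 := by
          have hc : Tendsto θ (𝓝[>] A) (𝓝 0) := by
            rw [← hzero A le_rfl]
            exact (hθ.isTravelingWave.continuousOn.continuousAt
              (Iio_mem_nhds hA)).continuousWithinAt
          refine ge_of_tendsto hc ?_
          filter_upwards [Ioo_mem_nhdsGT hA] with y hy
          rw [heq y hy.2 (hpos y hy)]
          exact hφ.monotoneOn hAb (hlt y hy.2 (hpos y hy)) (by linarith [hy.1])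
        rw [hzero ξ h]
        exact (hφ.eq_zero_of_le hAb (le_antisymm hφA (hφ.mem_Ico _ hAb).1) (by linarith)).symm
      · exact heq ξ hξ (hpos ξ ⟨h, hξ⟩)

end IsSemiWavefrontFrom

end

/-! ### The type of the profile -/

section

variable {r c : ℝ} {f D g z : ℝ → ℝ}

theorem IsData.hasDerivAt_D (hd : IsData r f D g) {s : ℝ} (hs : s ∈ Ioo 0 r) :
    HasDerivAt D (dot r D s) s :=
  ((hd.D_contDiffOn.differentiableOn one_ne_zero) s
    (Ioo_subset_Icc_self hs)).hasDerivWithinAt.hasDerivAt (Icc_mem_nhds hs.1 hs.2)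

theorem IsData.continuousOn_dot_D (hr : 0 < r) (hd : IsData r f D g) :
    ContinuousOn (dot r D) (Icc 0 r) :=
  hd.D_contDiffOn.continuousOn_derivWithin (uniqueDiffOn_Icc hr) le_rfl

theorem IsData.dot_D_nonneg (hr : 0 < r) (hd : IsData r f D g) (hD : DHat r D) (hD0 : D 0 = 0) :
    0 ≤ dot r D 0 := by
  have h : HasDerivWithinAt D (dot r D 0) (Icc 0 r) 0 :=
    ((hd.D_contDiffOn.differentiableOn one_ne_zero) 0 ⟨le_rfl, hr.le⟩).hasDerivWithinAt
  have h1 : HasDerivWithinAt D (dot r D 0) (Ioo 0 r) 0 := h.mono Ioo_subset_Icc_self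
  have h2 := hasDerivWithinAt_iff_tendsto_slope.1 h1
  rw [sdiff_singleton_eq_self (by simp), nhdsWithin_Ioo_eq_nhdsGT hr] at h2
  refine ge_of_tendsto h2 ?_
  filter_upwards [Ioo_mem_nhdsGT hr] with s hs
  rw [slope_def_field, hD0, sub_zero, sub_zero]
  exact div_nonneg (hD s hs).le hs.1.le

/-- A function that is continuous on `[0, r]` and negative at `0` is negative near `0`. -/
theorem exists_forall_neg {r : ℝ} (hr : 0 < r) {F : ℝ → ℝ} (hF : ContinuousOn F (Icc 0 r))
    (h0 : F 0 < 0) : ∃ s₀ ∈ Ioo 0 r, ∀ s ∈ Ioo 0 s₀, F s < 0 := by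
  have h1 : ContinuousWithinAt F (Ioo 0 r) 0 := (hF 0 ⟨le_rfl, hr.le⟩).mono Ioo_subset_Icc_self
  rw [ContinuousWithinAt, nhdsWithin_Ioo_eq_nhdsGT hr] at h1
  obtain ⟨u, hu, hsub⟩ := mem_nhdsGT_iff_exists_Ioo_subset.1 (h1.eventually (gt_mem_nhds h0))
  have hu : 0 < u := hu
  obtain ⟨s₀, h2, h3⟩ := exists_between (lt_min hu hr)
  exact ⟨s₀, ⟨h2, h3.trans_le (min_le_right _ _)⟩,
    fun s hs => hsub ⟨hs.1, hs.2.trans (h3.trans_le (min_le_left _ _))⟩⟩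

theorem tendsto_div_of_pos (hr : 0 < r) (hd : IsData r f D g)
    (hz : IsFirstOrderSol r (rate r f c) (reaction D g) z) (hD0 : 0 < D 0) :
    Tendsto (fun s => z s / D s) (𝓝[>] 0) (𝓝 0) := by
  have h0 : (0 : ℝ) ∈ Ico 0 r := ⟨le_rfl, hr⟩
  have h := ((hz.continuousOn 0 h0).div
    ((hd.D_contDiffOn.continuousOn.mono Ico_subset_Icc_self) 0 h0) hD0.ne').mono
    Ioo_subset_Ico_self
  rw [ContinuousWithinAt, nhdsWithin_Ioo_eq_nhdsGT hr, Pi.div_apply, hz.zero, zero_div] at h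
  exact h

/-- The hypothesis `hlt` covers both `c > h(0)` and `c = h(0)` with `D'(0) > 0`. For each `η > 0`
the function `η D` is an upper barrier near `0`: where `z > η D`, one has `-D g / z ≤ -g / η`, which
tends to `0` at `0`, so `(z - η D)' < 0` there. -/
theorem tendsto_div_of_lt (hr : 0 < r) (hd : IsData r f D g) (hD : DHat r D) (hg : GHat r g)
    (hz : IsFirstOrderSol r (rate r f c) (reaction D g) z) (hD0 : D 0 = 0)
    (hlt : ∀ η > 0, dot r f 0 - c < η * dot r D 0) :
    Tendsto (fun s => z s / D s) (𝓝[>] 0) (𝓝 0) := by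
  refine tendsto_order.2 ⟨fun a ha => ?_, fun a ha => ?_⟩
  · filter_upwards [Ioo_mem_nhdsGT hr] with s hs
    exact ha.trans (div_pos (hz.pos s hs) (hD s hs))
  · obtain ⟨η, hη, hηa⟩ := exists_between ha
    obtain ⟨s₀, hs₀, hneg⟩ := exists_forall_neg hr
      (F := fun s => dot r f s - c - g s / η - η * dot r D s)
      ((((hd.continuousOn_dot hr).sub continuousOn_const).sub
        (hd.g_continuousOn.div_const η)).sub
        (continuousOn_const.mul (hd.continuousOn_dot_D hr)))
      (by simpa [hg.2] using hlt η hη)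
    filter_upwards [Ioo_mem_nhdsGT hs₀.1] with s hs
    have hsr : s ∈ Ioo 0 r := ⟨hs.1, hs.2.trans hs₀.2⟩
    have hsub : Icc 0 s ⊆ Ico 0 r := fun t ht => ⟨ht.1, ht.2.trans_lt hsr.2⟩
    have := nonpos_of_deriv_nonpos_of_pos (u := fun s => z s - η * D s) (a := 0) (b := s)
      ((hz.continuousOn.mono hsub).sub (continuousOn_const.mul
        (hd.D_contDiffOn.continuousOn.mono (hsub.trans Ico_subset_Icc_self))))
      (by simp [hz.zero, hD0]) (fun t ht hpos => ?_) s ⟨hs.1.le, le_rfl⟩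
    · refine lt_of_le_of_lt ?_ hηa
      rw [div_le_iff₀ (hD s hsr)]
      linarith
    · have htr : t ∈ Ioo 0 r := ⟨ht.1, ht.2.trans hsr.2⟩
      refine ⟨_, ?_, (hz.hasDerivAt t htr).sub ((hd.hasDerivAt_D htr).const_mul η)⟩
      have h1 := hneg t ⟨ht.1, ht.2.trans hs.2⟩
      have h2 : reaction D g t / z t ≤ -(g t / η) := by
        rw [← neg_div, div_le_div_iff₀ (hz.pos t htr) hη, reaction]
        have := mul_le_mul_of_nonneg_left (show η * D t ≤ z t by linarith)
          (neg_nonneg.2 (hg.nonpos t (Ioo_subset_Icc_self htr)))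
        linarith
      simp only [rate] at h1 ⊢
      linarith

/-- The quotient in the equation for `z` is nonnegative, so `z' ≥ h - c`, and a small multiple of
`D` grows more slowly than `z` near `0`. -/
theorem exists_mul_le_of_lt (hr : 0 < r) (hd : IsData r f D g) (hD : DHat r D) (hg : GHat r g)
    (hz : IsFirstOrderSol r (rate r f c) (reaction D g) z) (hD0 : D 0 = 0)
    (hlt : c < dot r f 0) : ∃ κ > 0, ∀ᶠ s in 𝓝[>] 0, κ * D s ≤ z s := by
  have hdot := hd.dot_D_nonneg hr hD hD0
  have hpos : 0 < dot r f 0 - c := sub_pos.2 hlt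
  -- This makes `κ * D'(0)` smaller than `h(0) - c`; the `+ 1` allows for `D'(0) = 0`.
  set κ := (dot r f 0 - c) / (2 * (dot r D 0 + 1)) with hκdef
  have hκ : 0 < κ := by positivity
  have hκ2 : κ * (2 * (dot r D 0 + 1)) = dot r f 0 - c := div_mul_cancel₀ _ (by positivity)
  obtain ⟨s₀, hs₀, hneg⟩ := exists_forall_neg hr (F := fun s => κ * dot r D s - (dot r f s - c))
    ((continuousOn_const.mul (hd.continuousOn_dot_D hr)).sub
      ((hd.continuousOn_dot hr).sub continuousOn_const))
    (by
      have : 0 ≤ κ * dot r D 0 := mul_nonneg hκ.le hdot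
      linarith)
  refine ⟨κ, hκ, ?_⟩
  filter_upwards [Ioo_mem_nhdsGT hs₀.1] with s hs
  have hsr : s ∈ Ioo 0 r := ⟨hs.1, hs.2.trans hs₀.2⟩
  have hsub : Icc 0 s ⊆ Ico 0 r := fun t ht => ⟨ht.1, ht.2.trans_lt hsr.2⟩
  have := nonpos_of_deriv_nonpos_of_pos (u := fun s => κ * D s - z s) (a := 0) (b := s)
    ((continuousOn_const.mul (hd.D_contDiffOn.continuousOn.mono
      (hsub.trans Ico_subset_Icc_self))).sub (hz.continuousOn.mono hsub))
    (by simp [hz.zero, hD0]) (fun t ht _ => ?_) s ⟨hs.1.le, le_rfl⟩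
  · linarith
  · have htr : t ∈ Ioo 0 r := ⟨ht.1, ht.2.trans hsr.2⟩
    refine ⟨_, ?_, ((hd.hasDerivAt_D htr).const_mul κ).sub (hz.hasDerivAt t htr)⟩
    have h1 := hneg t ⟨ht.1, ht.2.trans hs.2⟩
    have h2 : 0 ≤ reaction D g t / z t := by
      refine div_nonneg ?_ (hz.pos t htr).le
      rw [reaction, neg_nonneg]
      exact mul_nonpos_of_nonneg_of_nonpos (hD t htr).le
        (hg.nonpos t (Ioo_subset_Icc_self htr))
    simp only [rate] at h1 ⊢
    linarith

theorem exists_sol (hr : 0 < r) (hd : IsData r f D g) (hD : DHat r D) (hg : GHat r g) (c : ℝ) :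
    ∃ z, IsFirstOrderSol r (rate r f c) (reaction D g) z := by
  refine exists_firstOrderSol hr ((hd.continuousOn_dot hr).sub continuousOn_const)
    (hd.D_contDiffOn.continuousOn.mul hd.g_continuousOn).neg (fun s hs => ?_) fun s hs => ?_
  · rw [reaction, neg_nonneg]
    exact mul_nonpos_of_nonneg_of_nonpos (hD.nonneg hr hd s hs) (hg.nonpos s hs)
  · rw [reaction, neg_pos]
    exact mul_neg_of_pos_of_neg (hD s hs) (hg.1 s (Ioo_subset_Ioc_self hs))

end

/-! ### Examples with quadratic diffusivity and linear flux -/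

section

variable {r : ℝ}

theorem dot_linear (hr : 0 < r) (c : ℝ) {s : ℝ} (hs : s ∈ Icc 0 r) :
    dot r (fun s => c * s) s = c := by
  have h : HasDerivAt (fun s : ℝ => c * s) c s := by simpa using (hasDerivAt_id s).const_mul c
  exact h.hasDerivWithinAt.derivWithin (uniqueDiffOn_Icc hr s hs)

theorem dot_sq_zero (hr : 0 < r) : dot r (fun s => s ^ 2) 0 = 0 := by
  have h : HasDerivAt (fun s : ℝ => s ^ 2) 0 0 := by simpa using hasDerivAt_pow 2 (0 : ℝ)
  exact h.hasDerivWithinAt.derivWithin (uniqueDiffOn_Icc hr 0 ⟨le_rfl, hr.le⟩)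

theorem isData_quadratic (c : ℝ) {g : ℝ → ℝ} (hg : Continuous g) :
    IsData r (fun s => c * s) (fun s => s ^ 2) g where
  f_contDiffOn := by fun_prop
  f_zero := mul_zero c
  D_contDiffOn := by fun_prop
  g_continuousOn := hg.continuousOn

theorem dHat_quadratic : DHat r fun s => s ^ 2 := fun _ hs => pow_pos hs.1 2

/-- The examples are built backwards. A linear flux with `h = c` makes `k = 0`, so that a prescribed
`z` is a solution for `g = -z z' / D`. With `D = s ^ 2`, the choice `z = s ^ 3` has `z / D = s`,
which tends to `0`. -/
theorem isFirstOrderSol_cube (hr : 0 < r) (c : ℝ) :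
    IsFirstOrderSol r (rate r (fun s => c * s) c)
      (reaction (fun s => s ^ 2) fun s => -(3 * s ^ 3)) fun s => s ^ 3 where
  zero := by simp
  continuousOn := by fun_prop
  pos s hs := pow_pos hs.1 3
  hasDerivAt s hs := by
    refine (hasDerivAt_pow 3 s).congr_deriv ?_
    have := hs.1.ne'
    rw [rate, dot_linear hr c (Ioo_subset_Icc_self hs), reaction]
    push_cast
    field_simp
    ring
  bddAbove := ⟨r ^ 3, fun s hs => pow_le_pow_left₀ hs.1.le hs.2.le 3⟩

/-- The same device with `z = D`: the slope `z / D` is identically `1`, which produces a corner. -/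
theorem isFirstOrderSol_sq (hr : 0 < r) (c : ℝ) :
    IsFirstOrderSol r (rate r (fun s => c * s) c)
      (reaction (fun s => s ^ 2) fun s => -(2 * s)) fun s => s ^ 2 where
  zero := by simp
  continuousOn := by fun_prop
  pos s hs := pow_pos hs.1 2
  hasDerivAt s hs := by
    refine (hasDerivAt_pow 2 s).congr_deriv ?_
    have := hs.1.ne'
    rw [rate, dot_linear hr c (Ioo_subset_Icc_self hs), reaction]
    push_cast
    field_simp
    ring
  bddAbove := ⟨r ^ 2, fun s hs => pow_le_pow_left₀ hs.1.le hs.2.le 2⟩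

theorem exists_classical_example (hr : 0 < r) (c : ℝ) :
    ∃ f D g : ℝ → ℝ, IsData r f D g ∧ DHat r D ∧ GHat r g ∧
      D 0 = 0 ∧ dot r D 0 = 0 ∧ c = dot r f 0 ∧
      ∃ (b : ℝ) (φ : ℝ → ℝ), IsSemiWavefrontFrom r f D g c 0 b φ ∧
        IsClassicalOn r f D g c (Iio b) φ := by
  have hd : IsData r (fun s => c * s) (fun s => s ^ 2) fun s => -(3 * s ^ 3) :=
    isData_quadratic c (by fun_prop)
  have hg : GHat r fun s => -(3 * s ^ 3) :=
    ⟨fun s hs => neg_neg_of_pos (mul_pos three_pos (pow_pos hs.1 3)), by simp⟩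
  have hz := isFirstOrderSol_cube hr c
  obtain ⟨b, φ, -, hφ, -⟩ := exists_isProfile hr hd dHat_quadratic hg hz
  refine ⟨_, _, _, hd, dHat_quadratic, hg, by simp, dot_sq_zero hr,
    (dot_linear hr c ⟨le_rfl, hr.le⟩).symm, b, φ,
    hφ.isSemiWavefrontFrom hr hd dHat_quadratic hg hz,
    hφ.isClassicalOn_of_tendsto hr hd dHat_quadratic hg hz ?_⟩
  refine (tendsto_id.mono_left nhdsWithin_le_nhds).congr' ?_
  filter_upwards [self_mem_nhdsWithin] with s hs
  have : s ≠ 0 := ne_of_gt hs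
  simp only [id]
  field_simp

theorem exists_sharp_example (hr : 0 < r) (c : ℝ) :
    ∃ f D g : ℝ → ℝ, IsData r f D g ∧ DHat r D ∧ GHat r g ∧
      D 0 = 0 ∧ dot r D 0 = 0 ∧ c = dot r f 0 ∧
      ∃ (b : ℝ) (φ : ℝ → ℝ), IsSemiWavefrontFrom r f D g c 0 b φ ∧
        IsSharpAt r f D g c (Iio b) φ 0 := by
  have hd : IsData r (fun s => c * s) (fun s => s ^ 2) fun s => -(2 * s) :=
    isData_quadratic c (by fun_prop)
  have hg : GHat r fun s => -(2 * s) :=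
    ⟨fun s hs => neg_neg_of_pos (mul_pos two_pos hs.1), by simp⟩
  have hz := isFirstOrderSol_sq hr c
  obtain ⟨b, φ, -, hφ, -⟩ := exists_isProfile hr hd dHat_quadratic hg hz
  exact ⟨_, _, _, hd, dHat_quadratic, hg, by simp, dot_sq_zero hr,
    (dot_linear hr c ⟨le_rfl, hr.le⟩).symm, b, φ,
    hφ.isSemiWavefrontFrom hr hd dHat_quadratic hg hz,
    hφ.isSharpAt_of_le hr hd dHat_quadratic hg hz one_pos (by simp)⟩

end

end SemiWave

/-! ### The main theorem -/

theorem mainTheorem2 (r : ℝ) (hr : 0 < r) :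
    -- existence, uniqueness up to shifts, strictness and type of the profile
    (∀ f D g : ℝ → ℝ, SemiWave.IsData r f D g → SemiWave.DHat r D → SemiWave.GHat r g →
      ∀ c : ℝ, ∃ (b : ℝ) (φ : ℝ → ℝ),
        SemiWave.IsSemiWavefrontFrom r f D g c 0 b φ ∧
        SemiWave.IsClassicalOrSharp r f D g c (Set.Iio b) φ ∧
        SemiWave.IsStrict r f D g c (Set.Iio b) φ ∧
        (∀ (b' : ℝ) (φ' : ℝ → ℝ), SemiWave.IsSemiWavefrontFrom r f D g c 0 b' φ' →
          SemiWave.IsClassicalOrSharp r f D g c (Set.Iio b') φ' →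
          ∃ τ : ℝ, b' + τ ≤ b ∧ ∀ ξ < b', φ' ξ = φ (ξ + τ)) ∧
        (0 < D 0 → SemiWave.IsClassicalOn r f D g c (Set.Iio b) φ) ∧
        (D 0 = 0 →
          (c < SemiWave.dot r f 0 → SemiWave.IsSharpAt r f D g c (Set.Iio b) φ 0) ∧
          (SemiWave.dot r f 0 < c → SemiWave.IsClassicalOn r f D g c (Set.Iio b) φ) ∧
          (c = SemiWave.dot r f 0 → 0 < SemiWave.dot r D 0 →
            SemiWave.IsClassicalOn r f D g c (Set.Iio b) φ))) ∧
    -- if `D(0) = 0`, `c = h(0)` and `D'(0) = 0`, both types occur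
    (∀ c : ℝ,
      (∃ f D g : ℝ → ℝ, SemiWave.IsData r f D g ∧ SemiWave.DHat r D ∧ SemiWave.GHat r g ∧
        D 0 = 0 ∧ SemiWave.dot r D 0 = 0 ∧ c = SemiWave.dot r f 0 ∧
        ∃ (b : ℝ) (φ : ℝ → ℝ), SemiWave.IsSemiWavefrontFrom r f D g c 0 b φ ∧
          SemiWave.IsClassicalOn r f D g c (Set.Iio b) φ) ∧
      (∃ f D g : ℝ → ℝ, SemiWave.IsData r f D g ∧ SemiWave.DHat r D ∧ SemiWave.GHat r g ∧
        D 0 = 0 ∧ SemiWave.dot r D 0 = 0 ∧ c = SemiWave.dot r f 0 ∧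
        ∃ (b : ℝ) (φ : ℝ → ℝ), SemiWave.IsSemiWavefrontFrom r f D g c 0 b φ ∧
          SemiWave.IsSharpAt r f D g c (Set.Iio b) φ 0)) := by
  refine ⟨fun f D g hd hD hg c => ?_, fun c =>
    ⟨SemiWave.exists_classical_example hr c, SemiWave.exists_sharp_example hr c⟩⟩
  obtain ⟨z, hz⟩ := SemiWave.exists_sol hr hd hD hg c
  obtain ⟨b, φ, T, hφ, hT⟩ := SemiWave.exists_isProfile hr hd hD hg hz
  refine ⟨b, φ, hφ.isSemiWavefrontFrom hr hd hD hg hz, hφ.isClassicalOrSharp hr hd hD hg hz,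
    hφ.isStrict hr hd hD hg hz, fun b' φ' hφ' hcs => hφ'.exists_shift hr hd hD hg hz hφ hT hcs,
    fun hD0 => ?_, fun hD0 => ⟨fun hlt => ?_, fun hlt => ?_, fun heq hdot => ?_⟩⟩
  · exact hφ.isClassicalOn_of_tendsto hr hd hD hg hz (SemiWave.tendsto_div_of_pos hr hd hz hD0)
  · obtain ⟨κ, hκ, hle⟩ := SemiWave.exists_mul_le_of_lt hr hd hD hg hz hD0 hlt
    exact hφ.isSharpAt_of_le hr hd hD hg hz hκ hle
  -- For `c > h(0)` the comparison needs only `D'(0) ≥ 0`, a consequence of `D > 0 = D(0)`.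
  · refine hφ.isClassicalOn_of_tendsto hr hd hD hg hz
      (SemiWave.tendsto_div_of_lt hr hd hD hg hz hD0 fun η hη => ?_)
    exact (sub_neg.2 hlt).trans_le (mul_nonneg hη.le (hd.dot_D_nonneg hr hD hD0))
  · refine hφ.isClassicalOn_of_tendsto hr hd hD hg hz
      (SemiWave.tendsto_div_of_lt hr hd hD hg hz hD0 fun η hη => ?_)
    rw [← heq, sub_self]
    exact mul_pos hη hdot
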